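/- Let $G$ be a finite loopless graph, parallel edges allowed, with maximum degree $\Delta$ and chromatic index $\chi'(G)\ge\Delta+2$. Let $\varphi$ be a partial $k$-edge-colouring of $G$ (some edges receive colours from $\{1,\dots,k\}$, adjacent edges never the same one) with $k\ge\Delta+1$, and let $e_0$ be an edge uncoloured by $\varphi$. A colour is missing at a vertex if no edge at that vertex has it. A set of vertices is $\varphi$-elementary if no two distinct vertices of it have a common missing colour. A Kempe change switches two colours $a,b$ on one component of the subgraph formed by the edges coloured $a$ or $b$. A $\varphi$-Tashkinov tree starting at $e_0$ is a tree obtained from $e_0$ and its two ends by repeatedly adding a new vertex $v$ together with an edge that joins $v$ to a vertex of the current tree and whose colour is missing at some vertex of the current tree; all maximal such trees have the same vertex set, denoted $W=W^{\varphi}_{e_0}$. A colour is defective if it occurs on more than one edge having exactly one end in $W$. For a graph $H$, $\rho(H)$ is the maximum of $2|E(H[S])|/(|S|-1)$ over all $S\subseteq V(H)$ with $|S|$ odd and at least $3$ (and $0$ if there is no such $S$). Suppose that none of the following holds: (1) there is a sequence of Kempe changes that transforms $\varphi$ into a colouring in which the two ends of $e_0$ have a common missing colour; (2) there is a sequence of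 Kempe changes that transforms $\varphi$ into a colouring $\varphi'$ with $|W^{\varphi'}_{e_0}|>|W^{\varphi}_{e_0}|$; (3) $\chi'(G)\ge\lceil\rho(G[W])\rceil>k$. Then all of the following hold. (a) $W$ is $\varphi$-elementary, there is at least one defective colour, and each defective colour occurs on an odd number of edges having exactly one end in $W$. (b) Let $T$ be any maximal $\varphi$-Tashkinov tree starting at $e_0$, let $\beta$ be a colour that is missing at some vertex of $W$ and is not used on any edge of $T$, and let $\alpha$ be a defective colour. Then there is a unique path $P$ that starts in $W$ and is a whole component of the subgraph formed by the edges coloured $\alpha$ or $\beta$ (the maximal $(\alpha,\beta)$-alternating path starting in $W$). It contains every $\alpha$-coloured edge having exactly one end in $W$. Moreover $P$ has at least two vertices outside $W$, and if $w_1,w_2$ are the first two of them, in the order of $P$, then $W\cup\{w_1,w_2\}$ is $\varphi$-elementary. (c) For $T,\alpha,\beta,P,w_1$ as in (b), let $Q$ be the vertex set of the longest segment of $P$ that starts at $w_1$ and contains no vertex of $W$. Then $W\cup Q$ is $\varphi$-elementary. -/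

import Mathlib

namespace EdgeColouring

/-- The maximum degree `Δ(G)` of a loopless finite multigraph; the degree of `x` is the number
of edges incident with `x`. -/
noncomputable def maxDegree {α β : Type*} (G : Graph α β) : ℕ :=
  sSup {d | ∃ x ∈ G.vertexSet, d = (G.incidenceSet x).ncard}

/-- `φ` is a partial `k`-edge-colouring of `G`: only edges of `G` receive colours (`none` stands
for "uncoloured"), and distinct edges with a common end never receive the same colour. -/
structure IsPartialColouring {α β : Type*} {k : ℕ} (G : Graph α β) (φ : β → Option (Fin k)) :
    Prop where
  mem_edgeSet : ∀ e c, φ e = some c → e ∈ G.edgeSet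
  proper : ∀ e f x c, e ≠ f → G.Inc e x → G.Inc f x → φ e = some c → φ f ≠ some c

/-- The chromatic index `χ'(G)`: the least `k` such that `G` has a (total) `k`-edge-colouring. -/
noncomputable def chromaticIndex {α β : Type*} (G : Graph α β) : ℕ :=
  sInf {k | ∃ φ : β → Option (Fin k), IsPartialColouring G φ ∧ ∀ e ∈ G.edgeSet, φ e ≠ none}

/-- The density `ρ(G)`: the maximum of `2|E(G[S])| / (|S| - 1)` over the sets `S` of vertices of
odd size at least three (and `0` if there is no such `S`). -/
noncomputable def density {α β : Type*} (G : Graph α β) : ℝ :=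
  sSup {r | ∃ S ⊆ G.vertexSet, Odd S.ncard ∧ 3 ≤ S.ncard ∧
    r = 2 * ((G.induce S).edgeSet.ncard : ℝ) / ((S.ncard : ℝ) - 1)}

section Colouring

variable {α β : Type*} {k : ℕ} (G : Graph α β) (φ : β → Option (Fin k))

/-- The colour `c` is missing at the vertex `x`: no edge incident with `x` has colour `c`. -/
def Missing (c : Fin k) (x : α) : Prop :=
  ∀ e, G.Inc e x → φ e ≠ some c

/-- A set of vertices is elementary if no two distinct members have a common missing colour. -/
def IsElementary (S : Set α) : Prop :=
  ∀ x ∈ S, ∀ y ∈ S, x ≠ y → ∀ c, ¬ (Missing G φ c x ∧ Missing G φ c y)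

/-- `x` and `y` lie in the same component of the subgraph formed by the edges of colours
`a` and `b`. -/
def SameComponent (a b : Fin k) (x y : α) : Prop :=
  Relation.ReflTransGen
    (fun u v => ∃ e, G.IsLink e u v ∧ (φ e = some a ∨ φ e = some b)) x y

open Classical in
/-- Switch the colours `a` and `b` on the component containing `x` of the subgraph formed by the
edges of colours `a` and `b`. -/
noncomputable def kempeSwitch (a b : Fin k) (x : α) : β → Option (Fin k) :=
  fun e => if ∃ y, SameComponent G φ a b x y ∧ G.Inc e y then (φ e).map (Equiv.swap a b) else φ e

/-- `ψ` is obtained from `φ` by a (possibly empty) finite sequence of Kempe changes. -/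
def KempeReachable (ψ : β → Option (Fin k)) : Prop :=
  Relation.ReflTransGen (fun φ₁ φ₂ : β → Option (Fin k) =>
    ∃ a b x, a ≠ b ∧ x ∈ G.vertexSet ∧ φ₂ = kempeSwitch G φ₁ a b x) φ ψ

/-- Membership in the vertex set `W` grown from the edge `e₀`: the ends of `e₀` belong to it, and
so does every `v` joined to a member `u` by an edge whose colour is missing at a member `w`. -/
inductive MemW (e₀ : β) : α → Prop
  | start (x : α) : G.Inc e₀ x → MemW e₀ x
  | grow (u v w : α) (e : β) (c : Fin k) : MemW e₀ u → G.IsLink e u v → φ e = some c →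
      MemW e₀ w → Missing G φ c w → MemW e₀ v

/-- The set `W` of all vertices of a maximal Tashkinov tree starting at `e₀`. -/
def W (e₀ : β) : Set α := {x | MemW G φ e₀ x}

/-- `S` and `F` are the vertex set and the edge set of a Tashkinov tree starting at `e₀`. -/
inductive IsTashkinovTree (e₀ : β) : Set α → Set β → Prop
  | start (x y : α) : G.IsLink e₀ x y → IsTashkinovTree e₀ {x, y} {e₀}
  | grow (S : Set α) (F : Set β) (u v w : α) (e : β) (c : Fin k) : IsTashkinovTree e₀ S F →
      u ∈ S → v ∉ S → G.IsLink e u v → φ e = some c → w ∈ S → Missing G φ c w →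
      IsTashkinovTree e₀ (insert v S) (insert e F)

/-- `T`, given as a pair (vertex set, edge set), is a maximal Tashkinov tree starting at `e₀`. -/
def IsMaximalTashkinovTree (e₀ : β) (T : Set α × Set β) : Prop :=
  Maximal (fun T : Set α × Set β => IsTashkinovTree G φ e₀ T.1 T.2) T

/-- The set of colours used on the edges in `F`. -/
def usedColours (F : Set β) : Set (Fin k) := {c | ∃ e ∈ F, φ e = some c}

/-- The set of colours missing at some vertex of `S`. -/
def missingColours (S : Set α) : Set (Fin k) := {c | ∃ x ∈ S, Missing G φ c x}

/-- The edges of colour `c` having exactly one end in `S`. -/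
def boundaryEdges (S : Set α) (c : Fin k) : Set β :=
  {e | φ e = some c ∧ ∃ x ∈ S, ∃ y, y ∉ S ∧ G.IsLink e x y}

/-- The defective colours of `S`: those on more than one edge leaving `S`. -/
def defectiveColours (S : Set α) : Set (Fin k) := {c | 1 < (boundaryEdges G φ S c).ncard}

end Colouring

/-- A pair of lists recording the successive vertices and the successive edges of a path. -/
structure PathData (α β : Type*) where
  verts : List α
  edges : List β

section Paths

variable {α β : Type*} {k : ℕ} (G : Graph α β) (φ : β → Option (Fin k))

/-- `P` is an `(a, b)`-alternating path: its vertices are distinct vertices of `G`, successive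
vertices are joined by the successive edges, all edges have colour `a` or `b`, and successive edges
have different colours. -/
structure IsAlternatingPath (a b : Fin k) (P : PathData α β) : Prop where
  length_eq : P.verts.length = P.edges.length + 1
  nodup : P.verts.Nodup
  subset : ∀ x ∈ P.verts, x ∈ G.vertexSet
  isLink : ∀ (i : ℕ) (h : i < P.edges.length),
    G.IsLink (P.edges[i]'h) (P.verts[i]'(by omega)) (P.verts[i + 1]'(by omega))
  colour : ∀ e ∈ P.edges, φ e = some a ∨ φ e = some b
  alternate : ∀ (i : ℕ) (h : i + 1 < P.edges.length),
    φ (P.edges[i]'(by omega)) ≠ φ (P.edges[i + 1]'h)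

/-- `P` is a maximal `(a, b)`-alternating path, i.e. a whole component of the subgraph formed by
the edges of colours `a` and `b`: every edge of colour `a` or `b` that meets `P` is an edge
of `P`. -/
structure IsMaximalAlternatingPath (a b : Fin k) (P : PathData α β) : Prop where
  isPath : IsAlternatingPath G φ a b P
  maximal : ∀ e x, x ∈ P.verts → G.Inc e x → (φ e = some a ∨ φ e = some b) → e ∈ P.edges

/-- `P` is a maximal `(a, b)`-alternating path whose first vertex lies in `S`. -/
def IsMaximalAlternatingPathFrom (S : Set α) (a b : Fin k) (P : PathData α β) : Prop :=
  IsMaximalAlternatingPath G φ a b P ∧ ∃ x ∈ S, P.verts.head? = some x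

open Classical in
/-- The vertices of `P` outside `S`, in the order of `P`. -/
noncomputable def outsideVerts (S : Set α) (P : PathData α β) : List α :=
  P.verts.filter (fun x => decide (x ∉ S))

open Classical in
/-- The longest segment of `P` that starts at the first vertex of `P` outside `S` and contains no
vertex of `S`. -/
noncomputable def outsideSegment (S : Set α) (P : PathData α β) : List α :=
  (P.verts.dropWhile (fun x => decide (x ∈ S))).takeWhile (fun x => decide (x ∉ S))

end Paths

end EdgeColouring

/-! All arguments take place in the class of colourings reachable from `φ` by Kempe changes. By
failure of (1), the ends of `e₀` never acquire a common missing colour in this class; by failure of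
(2), no colouring in it gives a larger `W` than `φ` does.

Tashkinov's theorem (`KempeClass.allElementary`) shows that every Tashkinov tree of every colouring
in the class is elementary. Hence a colour missing in `W` is missing at exactly one vertex and on no
edge leaving `W`, so `|W|` is odd, and every other colour leaves `W` on an odd number of edges. If
none were defective, every colour would have exactly `(|W| - 1) / 2` edges inside `W`; together with
`e₀` this makes the density exceed `k`, while counting matchings bounds the density by the chromatic
index, contrary to the failure of (3).

For (b), let `v` be the vertex of `W` missing `β`. An `α`-edge leaving `W` outside the component of
`v` could be recoloured `β` by a switch that preserves `T` and leaves `β` missing at `v`, and `W`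
would grow (`KempeClass.sameComponent_of_boundary`). So the path from `v` contains all these edges;
as there are several, it leaves `W` and returns. Both crossings have colour `α`, so they cannot
share their outer vertex.

For (c), which also gives the elementarity in (b), induction runs along the outer segment, over all
colourings in which the tree and the path survive (`IsExitChain.isElementary_exitSet`). Kempe
changes transport a repeated missing colour until some switch makes the path stop before its return
to `W`. This is impossible, since the path must contain all the boundary edges of colour `α`
(`IsExitChain.false_of_short`). -/

namespace EdgeColouring

/-! ### Kempe changes and their effect on missing colours -/

section Kempe

variable {α β : Type*} {k : ℕ} {G : Graph α β} {φ : β → Option (Fin k)} {a b c : Fin k}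
  {x y z : α} {e f : β}

lemma SameComponent.trans (h : SameComponent G φ a b x y) (h' : SameComponent G φ a b y z) :
    SameComponent G φ a b x z :=
  Relation.ReflTransGen.trans h h'

lemma SameComponent.symm (h : SameComponent G φ a b x y) : SameComponent G φ a b y x := by
  induction h with
  | refl => exact Relation.ReflTransGen.refl
  | tail _ h ih =>
    obtain ⟨e, he, hc⟩ := h
    exact Relation.ReflTransGen.head ⟨e, he.symm, hc⟩ ih

lemma sameComponent_self : SameComponent G φ a b x x := Relation.ReflTransGen.refl

lemma sameComponent_of_isLink (h : G.IsLink e x y) (hc : φ e = some a ∨ φ e = some b) :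
    SameComponent G φ a b x y :=
  Relation.ReflTransGen.single ⟨e, h, hc⟩

lemma sameComponent_of_inc (hx : G.Inc e x) (hy : G.Inc e y)
    (hc : φ e = some a ∨ φ e = some b) : SameComponent G φ a b x y := by
  obtain ⟨z, hz⟩ := hx
  obtain rfl | rfl := hy.eq_or_eq_of_isLink hz
  · exact sameComponent_self
  · exact sameComponent_of_isLink hz hc

/-- The component of a vertex missing both colours is trivial. -/
lemma SameComponent.eq_of_missing (h : SameComponent G φ a b x y) (ha : Missing G φ a x)
    (hb : Missing G φ b x) : y = x := by
  induction h with
  | refl => rfl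
  | tail _ h ih =>
    obtain ⟨e, he, hc⟩ := h
    subst ih
    rcases hc with hc | hc
    · exact (ha e he.inc_left hc).elim
    · exact (hb e he.inc_left hc).elim

/-- A component leaves a set of vertices through an edge of one of the two colours. -/
lemma SameComponent.exists_boundary {S : Set α} (h : SameComponent G φ a b x y) (hx : x ∉ S)
    (hy : y ∈ S) : ∃ e u v, G.IsLink e u v ∧ (φ e = some a ∨ φ e = some b) ∧ u ∈ S ∧ v ∉ S ∧
      SameComponent G φ a b x u := by
  induction h with
  | refl => exact (hx hy).elim
  | @tail u v huv h ih =>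
    by_cases hu : u ∈ S
    · exact ih hu
    · obtain ⟨e, he, hc⟩ := h
      exact ⟨e, v, u, he.symm, hc, hy, hu, huv.tail ⟨e, he, hc⟩⟩

lemma kempeSwitch_of_mem (hy : G.Inc e y) (h : SameComponent G φ a b x y) :
    kempeSwitch G φ a b x e = (φ e).map (Equiv.swap a b) :=
  if_pos ⟨y, h, hy⟩

lemma map_swap_of_ne {o : Option (Fin k)} (ha : o ≠ some a) (hb : o ≠ some b) :
    o.map (Equiv.swap a b) = o := by
  cases o with
  | none => rfl
  | some c => simp_all [Equiv.swap_apply_of_ne_of_ne]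

/-- `kempeSwitch` asks for some end in the component. An edge with one end inside and one outside
has neither of the two colours, so the swap fixes it; thus any single end decides. -/
lemma kempeSwitch_of_not_mem (hy : G.Inc e y) (h : ¬ SameComponent G φ a b x y) :
    kempeSwitch G φ a b x e = φ e := by
  unfold kempeSwitch
  split_ifs with h'
  · obtain ⟨z, hz, hez⟩ := h'
    refine map_swap_of_ne ?_ ?_
    · exact fun hc => h (hz.trans (sameComponent_of_inc hez hy (Or.inl hc)))
    · exact fun hc => h (hz.trans (sameComponent_of_inc hez hy (Or.inr hc)))
  · rfl

lemma kempeSwitch_eq_or :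
    kempeSwitch G φ a b x e = (φ e).map (Equiv.swap a b) ∨ kempeSwitch G φ a b x e = φ e := by
  unfold kempeSwitch
  split_ifs <;> simp

lemma map_swap_eq_some_iff {o : Option (Fin k)} :
    o.map (Equiv.swap a b) = some c ↔ o = some (Equiv.swap a b c) := by
  cases o with
  | none => simp
  | some d => simp [Equiv.swap_apply_eq_iff]

lemma kempeSwitch_eq_some_iff_of_ne (ha : c ≠ a) (hb : c ≠ b) :
    kempeSwitch G φ a b x e = some c ↔ φ e = some c := by
  rcases kempeSwitch_eq_or (G := G) (φ := φ) (a := a) (b := b) (x := x) (e := e) with h | h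
  · rw [h, map_swap_eq_some_iff, Equiv.swap_apply_of_ne_of_ne ha hb]
  · rw [h]

lemma kempeSwitch_mem_pair_iff :
    (kempeSwitch G φ a b x e = some a ∨ kempeSwitch G φ a b x e = some b) ↔
      (φ e = some a ∨ φ e = some b) := by
  rcases kempeSwitch_eq_or (G := G) (φ := φ) (a := a) (b := b) (x := x) (e := e) with h | h
  · rw [h, map_swap_eq_some_iff, map_swap_eq_some_iff, Equiv.swap_apply_left,
      Equiv.swap_apply_right, or_comm]
  · rw [h]

lemma kempeSwitch_eq_none_iff : kempeSwitch G φ a b x e = none ↔ φ e = none := by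
  rcases kempeSwitch_eq_or (G := G) (φ := φ) (a := a) (b := b) (x := x) (e := e) with h | h
  · rw [h, Option.map_eq_none_iff]
  · rw [h]

lemma missing_kempeSwitch_of_mem (h : SameComponent G φ a b x y) :
    Missing G (kempeSwitch G φ a b x) c y ↔ Missing G φ (Equiv.swap a b c) y := by
  refine forall₂_congr fun e he => ?_
  rw [kempeSwitch_of_mem he h, ne_eq, map_swap_eq_some_iff]

lemma missing_kempeSwitch_of_not_mem (h : ¬ SameComponent G φ a b x y) :
    Missing G (kempeSwitch G φ a b x) c y ↔ Missing G φ c y := by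
  refine forall₂_congr fun e he => ?_
  rw [kempeSwitch_of_not_mem he h]

lemma missing_kempeSwitch_of_ne (ha : c ≠ a) (hb : c ≠ b) :
    Missing G (kempeSwitch G φ a b x) c y ↔ Missing G φ c y :=
  forall₂_congr fun _ _ => not_congr (kempeSwitch_eq_some_iff_of_ne ha hb)

lemma missing_kempeSwitch_left (h : SameComponent G φ a b x y) :
    Missing G (kempeSwitch G φ a b x) a y ↔ Missing G φ b y := by
  rw [missing_kempeSwitch_of_mem h, Equiv.swap_apply_left]

lemma missing_kempeSwitch_right (h : SameComponent G φ a b x y) :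
    Missing G (kempeSwitch G φ a b x) b y ↔ Missing G φ a y := by
  rw [missing_kempeSwitch_of_mem h, Equiv.swap_apply_right]

/-- Around a given vertex either all edges are subjected to the swap or none is, and the swap is a
bijection. -/
lemma IsPartialColouring.kempeSwitch (h : IsPartialColouring G φ) :
    IsPartialColouring G (kempeSwitch G φ a b x) where
  mem_edgeSet e c hc := by
    obtain ⟨d, hd⟩ : ∃ d, φ e = some d := by
      rw [← Option.ne_none_iff_exists', ne_eq,
        ← kempeSwitch_eq_none_iff (G := G) (a := a) (b := b) (x := x), hc]
      simp
    exact h.mem_edgeSet e d hd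
  proper e f y c hne he hf hc := by
    by_cases hy : SameComponent G φ a b x y
    · rw [kempeSwitch_of_mem he hy, map_swap_eq_some_iff] at hc
      rw [kempeSwitch_of_mem hf hy, ne_eq, map_swap_eq_some_iff]
      exact h.proper e f y _ hne he hf hc
    · rw [kempeSwitch_of_not_mem he hy] at hc
      rw [kempeSwitch_of_not_mem hf hy]
      exact h.proper e f y c hne he hf hc

lemma IsPartialColouring.eq_of_inc (h : IsPartialColouring G φ) (he : G.Inc e x)
    (hf : G.Inc f x) (hec : φ e = some c) (hfc : φ f = some c) : e = f :=
  by_contra fun hne => h.proper e f x c hne he hf hec hfc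

end Kempe

/-! ### Alternating chains -/

section Chains

variable {α β : Type*} {k : ℕ}

/-- The vertices `f 0, …, f m` and the edges `g 0, …, g (m - 1)` form a path all of whose edges
have colour `a` or `b`. -/
structure IsChain (G : Graph α β) (φ : β → Option (Fin k)) (a b : Fin k) (m : ℕ) (f : ℕ → α)
    (g : ℕ → β) : Prop where
  inj : ∀ i ≤ m, ∀ j ≤ m, f i = f j → i = j
  isLink : ∀ i < m, G.IsLink (g i) (f i) (f (i + 1))
  colour : ∀ i < m, φ (g i) = some a ∨ φ (g i) = some b

/-- The chain is a whole component. -/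
def IsClosedChain (G : Graph α β) (φ : β → Option (Fin k)) (a b : Fin k) (m : ℕ) (f : ℕ → α)
    (g : ℕ → β) : Prop :=
  ∀ i ≤ m, ∀ e, G.Inc e (f i) → (φ e = some a ∨ φ e = some b) → ∃ j < m, e = g j

variable {G : Graph α β} {φ : β → Option (Fin k)} {a b : Fin k} {m : ℕ} {f : ℕ → α} {g : ℕ → β}
  {x y z : α}

lemma IsChain.mono (h : IsChain G φ a b m f g) {n : ℕ} (hn : n ≤ m) : IsChain G φ a b n f g where
  inj i hi j hj := h.inj i (hi.trans hn) j (hj.trans hn)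
  isLink i hi := h.isLink i (by omega)
  colour i hi := h.colour i (by omega)

lemma IsChain.edge_ne (h : IsChain G φ a b m f g) {i : ℕ} (hi : i + 1 < m) : g i ≠ g (i + 1) := by
  intro he
  have h1 := h.isLink i (by omega)
  have h2 := h.isLink (i + 1) hi
  rw [← he] at h2
  rcases h1.left_eq_or_eq h2 with h3 | h3
  · have := h.inj _ (by omega) _ (by omega) h3; omega
  · have := h.inj _ (by omega) _ (by omega) h3; omega

lemma IsChain.colour_ne (h : IsChain G φ a b m f g) (hφ : IsPartialColouring G φ) {i : ℕ}
    (hi : i + 1 < m) : φ (g i) ≠ φ (g (i + 1)) := by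
  intro he
  rcases h.colour i (by omega) with hc | hc <;>
  exact h.edge_ne hi (hφ.eq_of_inc (h.isLink i (by omega)).inc_right (h.isLink (i + 1) hi).inc_left
    hc (he ▸ hc))

/-- An interior vertex already meets both colours on its two chain edges, so properness leaves no
room for another edge. -/
lemma IsChain.eq_edge_of_interior (h : IsChain G φ a b m f g) (hφ : IsPartialColouring G φ)
    {i : ℕ} (hi0 : 0 < i) (him : i < m) {e : β} (he : G.Inc e (f i))
    (hc : φ e = some a ∨ φ e = some b) : ∃ j < m, e = g j := by
  obtain ⟨j, rfl⟩ : ∃ j, i = j + 1 := ⟨i - 1, by omega⟩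
  have h1 := h.colour j (by omega)
  have h2 := h.colour (j + 1) him
  have h3 := h.colour_ne hφ him
  have h4 := (h.isLink j (by omega)).inc_right
  have h5 := (h.isLink (j + 1) him).inc_left
  by_cases h6 : φ e = φ (g j)
  · refine ⟨j, by omega, ?_⟩
    rcases h1 with h1 | h1 <;> exact hφ.eq_of_inc he h4 (h6.trans h1) h1
  · refine ⟨j + 1, him, ?_⟩
    have h7 : φ e = φ (g (j + 1)) := by
      rcases h1 with h1 | h1 <;> rcases h2 with h2 | h2 <;> rcases hc with hc | hc <;> simp_all
    rcases h2 with h2 | h2 <;> exact hφ.eq_of_inc he h5 (h7.trans h2) h2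

/-- If an end of the chain misses one of the colours, then all edges there belong to the chain. -/
lemma IsChain.eq_edge_of_missing (hφ : IsPartialColouring G φ) {e e' : β}
    (hx : Missing G φ a x ∨ Missing G φ b x) (he : G.Inc e x) (he' : G.Inc e' x)
    (hc : φ e = some a ∨ φ e = some b) (hc' : φ e' = some a ∨ φ e' = some b) : e = e' := by
  rcases hx with hx | hx
  · exact hφ.eq_of_inc he he' (hc.resolve_left (hx e he)) (hc'.resolve_left (hx e' he'))
  · exact hφ.eq_of_inc he he' (hc.resolve_right (hx e he)) (hc'.resolve_right (hx e' he'))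

lemma IsChain.isClosedChain (h : IsChain G φ a b m f g) (hφ : IsPartialColouring G φ)
    (hm : 0 < m) (h0 : Missing G φ a (f 0) ∨ Missing G φ b (f 0))
    (h1 : Missing G φ a (f m) ∨ Missing G φ b (f m)) : IsClosedChain G φ a b m f g := by
  intro i hi e he hc
  rcases Nat.eq_zero_or_pos i with rfl | hi0
  · exact ⟨0, hm, eq_edge_of_missing hφ h0 he (h.isLink 0 hm).inc_left hc (h.colour 0 hm)⟩
  rcases hi.eq_or_lt with rfl | him
  · refine ⟨i - 1, by omega, ?_⟩
    have h2 := (h.isLink (i - 1) (by omega)).inc_right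
    rw [Nat.sub_add_cancel hi0] at h2
    exact eq_edge_of_missing hφ h1 he h2 hc (h.colour (i - 1) (by omega))
  · exact h.eq_edge_of_interior hφ hi0 him he hc

lemma IsClosedChain.exists_of_sameComponent (hc : IsClosedChain G φ a b m f g)
    (h : IsChain G φ a b m f g) (hy : SameComponent G φ a b (f 0) y) : ∃ i ≤ m, y = f i := by
  induction hy with
  | refl => exact ⟨0, by omega, rfl⟩
  | @tail u v _ huv ih =>
    obtain ⟨i, hi, rfl⟩ := ih
    obtain ⟨e, he, hec⟩ := huv
    obtain ⟨j, hj, rfl⟩ := hc i hi e he.inc_left hec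
    rcases he.inc_right.eq_or_eq_of_isLink (h.isLink j hj) with h' | h'
    · exact ⟨j, by omega, h'⟩
    · exact ⟨j + 1, by omega, h'⟩

lemma IsChain.not_missing_of_interior (h : IsChain G φ a b m f g) (hφ : IsPartialColouring G φ)
    {i : ℕ} (hi0 : 0 < i) (him : i < m) : ¬ Missing G φ a (f i) ∧ ¬ Missing G φ b (f i) := by
  obtain ⟨j, rfl⟩ : ∃ j, i = j + 1 := ⟨i - 1, by omega⟩
  have h1 := h.colour j (by omega)
  have h2 := h.colour (j + 1) him
  have h3 := h.colour_ne hφ him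
  have h4 := (h.isLink j (by omega)).inc_right
  have h5 := (h.isLink (j + 1) him).inc_left
  constructor
  · intro hm
    have h6 := hm _ h4
    have h7 := hm _ h5
    rw [h1.resolve_left h6, h2.resolve_left h7] at h3
    exact h3 rfl
  · intro hm
    have h6 := hm _ h4
    have h7 := hm _ h5
    rw [h1.resolve_right h6, h2.resolve_right h7] at h3
    exact h3 rfl

/-- From a vertex missing one of the two colours starts a chain that is a whole component. -/
lemma exists_isClosedChain [Nonempty β] [G.Loopless] (hV : G.vertexSet.Finite)
    (hφ : IsPartialColouring G φ) (h0 : Missing G φ a x ∨ Missing G φ b x) :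
    ∃ m f g, f 0 = x ∧ IsChain G φ a b m f g ∧ IsClosedChain G φ a b m f g := by
  classical
  -- A longest chain from `x` is taken; its left ends are distinct vertices, which bounds its
  -- length.
  let p : ℕ → Prop := fun m => ∃ f g, f 0 = x ∧ IsChain G φ a b m f g
  have hbound : ∀ m, p m → m ≤ G.vertexSet.ncard := by
    rintro m ⟨f, g, hf0, h⟩
    have hmem : ∀ i ∈ Finset.range m, f i ∈ G.vertexSet := fun i hi =>
      (h.isLink i (Finset.mem_range.1 hi)).left_mem
    have := Finset.card_le_card_of_injOn (s := Finset.range m) (t := hV.toFinset) f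
      (fun i hi => by simpa using hmem i (by simpa using hi))
      (fun i hi j hj hij => h.inj i (by simp at hi; omega) j (by simp at hj; omega) hij)
    rwa [Finset.card_range, ← Set.ncard_eq_toFinset_card _ hV] at this
  have hp0 : p 0 := ⟨fun _ => x, fun _ => Classical.arbitrary β, rfl,
    ⟨by omega, by omega, by omega⟩⟩
  obtain ⟨m, ⟨f, g, hf0, h⟩, hmax⟩ : ∃ m, p m ∧ ∀ n, p n → n ≤ m :=
    ⟨Nat.findGreatest p G.vertexSet.ncard, Nat.findGreatest_spec (Nat.zero_le _) hp0,
      fun n hn => Nat.le_findGreatest (hbound n hn) hn⟩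
  refine ⟨m, f, g, hf0, h, ?_⟩
  rw [← hf0] at h0
  -- An edge from the last vertex to a new vertex would prolong the longest chain.
  have hext : ∀ e v, G.IsLink e (f m) v → (φ e = some a ∨ φ e = some b) → ∃ i ≤ m, v = f i := by
    intro e v he hc
    by_contra! hv
    refine absurd (hmax (m + 1) ⟨fun i => if i ≤ m then f i else v,
      fun i => if i < m then g i else e, by simp [hf0], ⟨?_, ?_, ?_⟩⟩) (by omega)
    · intro i hi j hj hij
      split_ifs at hij with h1 h2 h2
      · exact h.inj i h1 j h2 hij
      · exact (hv i h1 hij.symm).elim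
      · exact (hv j h2 hij).elim
      · omega
    · intro i hi
      rcases (Nat.lt_succ_iff.1 hi).eq_or_lt with rfl | hi'
      · simpa using he
      · simpa [hi', hi'.le, Nat.succ_le_iff.2 hi'] using h.isLink i hi'
    · intro i hi
      rcases (Nat.lt_succ_iff.1 hi).eq_or_lt with rfl | hi'
      · simpa using hc
      · simpa [hi'] using h.colour i hi'
  have hzero : ∀ e, 0 < m → G.Inc e (f 0) → (φ e = some a ∨ φ e = some b) → ∃ j < m, e = g j :=
    fun e hm he hc =>
      ⟨0, hm, IsChain.eq_edge_of_missing hφ h0 he (h.isLink 0 hm).inc_left hc (h.colour 0 hm)⟩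
  intro i hi e he hc
  rcases hi.eq_or_lt with rfl | him
  · obtain ⟨v, hv⟩ := he
    obtain ⟨j, hj, rfl⟩ := hext e v hv hc
    have hji : j < i := by
      refine lt_of_le_of_ne hj ?_
      rintro rfl
      exact hv.ne rfl
    rcases Nat.eq_zero_or_pos j with rfl | hj0
    · exact hzero e hji hv.inc_right hc
    · exact h.eq_edge_of_interior hφ hj0 hji hv.inc_right hc
  · rcases Nat.eq_zero_or_pos i with rfl | hi0
    · exact hzero e him he hc
    · exact h.eq_edge_of_interior hφ hi0 him he hc

/-- A component contains at most two vertices missing one of its two colours. -/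
lemma eq_or_eq_or_eq_of_sameComponent [Nonempty β] [G.Loopless] (hV : G.vertexSet.Finite)
    (hφ : IsPartialColouring G φ) (hx : Missing G φ a x ∨ Missing G φ b x)
    (hy : Missing G φ a y ∨ Missing G φ b y) (hz : Missing G φ a z ∨ Missing G φ b z)
    (hxy : SameComponent G φ a b x y) (hxz : SameComponent G φ a b x z) :
    x = y ∨ x = z ∨ y = z := by
  obtain ⟨m, f, g, rfl, h, hc⟩ := exists_isClosedChain hV hφ hx
  -- Interior vertices of the chain miss neither colour, so only its two ends qualify.
  have key : ∀ w, SameComponent G φ a b (f 0) w → (Missing G φ a w ∨ Missing G φ b w) →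
      w = f 0 ∨ w = f m := by
    intro w hw hm
    obtain ⟨i, hi, rfl⟩ := hc.exists_of_sameComponent h hw
    rcases Nat.eq_zero_or_pos i with rfl | hi0
    · exact Or.inl rfl
    rcases hi.eq_or_lt with rfl | him
    · exact Or.inr rfl
    · have := h.not_missing_of_interior hφ hi0 him
      tauto
  rcases key y hxy hy with h1 | h1
  · exact Or.inl h1.symm
  rcases key z hxz hz with h2 | h2
  · exact Or.inr (Or.inl h2.symm)
  · exact Or.inr (Or.inr (h1.trans h2.symm))

/-- If both ends of an edge of colour `a` miss `b`, then this edge is a whole component. -/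
lemma eq_or_eq_of_sameComponent_edge (hφ : IsPartialColouring G φ) {e : β} (he : G.IsLink e x y)
    (hc : φ e = some a) (hx : Missing G φ b x) (hy : Missing G φ b y)
    (hz : SameComponent G φ a b x z) : z = x ∨ z = y := by
  induction hz with
  | refl => exact Or.inl rfl
  | @tail u v _ huv ih =>
    obtain ⟨e', he', hc'⟩ := huv
    have hee : e' = e := by
      rcases ih with rfl | rfl
      · exact hφ.eq_of_inc he'.inc_left he.inc_left (hc'.resolve_right (hx _ he'.inc_left)) hc
      · exact hφ.eq_of_inc he'.inc_left he.inc_right (hc'.resolve_right (hy _ he'.inc_left)) hc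
    subst hee
    exact he'.inc_right.eq_or_eq_of_isLink he

end Chains

end EdgeColouring

namespace EdgeColouring

/-! ### Counting missing colours -/

section Counting

variable {α β : Type*} {k : ℕ} {G : Graph α β} {φ : β → Option (Fin k)}

open Classical in
lemma le_card_missing_add (hE : G.edgeSet.Finite) (x : α) :
    k ≤ (Finset.univ.filter fun c => Missing G φ c x).card +
      {e | G.Inc e x ∧ φ e ≠ none}.ncard := by
  have hfin : {e | G.Inc e x ∧ φ e ≠ none}.Finite := hE.subset fun e he => he.1.edge_mem
  have h1 := Finset.card_filter_add_card_filter_not (s := (Finset.univ : Finset (Fin k)))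
    (fun c => Missing G φ c x)
  rw [Finset.card_univ, Fintype.card_fin] at h1
  have h2 : (Finset.univ.filter fun c => ¬ Missing G φ c x).card ≤
      {e | G.Inc e x ∧ φ e ≠ none}.ncard := by
    rw [Set.ncard_eq_toFinset_card _ hfin]
    have hsub : (Finset.univ.filter fun c => ¬ Missing G φ c x).image some ⊆
        hfin.toFinset.image φ := by
      intro o ho
      simp only [Finset.mem_image, Finset.mem_filter, Finset.mem_univ, true_and] at ho
      obtain ⟨c, hc, rfl⟩ := ho
      unfold Missing at hc
      push Not at hc
      obtain ⟨e, he, hec⟩ := hc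
      simp only [Finset.mem_image, Set.Finite.mem_toFinset, Set.mem_ofPred_eq]
      exact ⟨e, ⟨he, by simp [hec]⟩, hec⟩
    have := (Finset.card_le_card hsub).trans Finset.card_image_le
    rwa [Finset.card_image_of_injective _ (Option.some_injective _)] at this
  omega

open Classical in
lemma one_le_card_missing (hE : G.edgeSet.Finite) {x : α} (hx : (G.incidenceSet x).ncard < k) :
    1 ≤ (Finset.univ.filter fun c => Missing G φ c x).card := by
  have h1 := le_card_missing_add (φ := φ) hE x
  have h2 : {e | G.Inc e x ∧ φ e ≠ none}.ncard ≤ (G.incidenceSet x).ncard :=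
    Set.ncard_le_ncard (fun e he => he.1) (hE.subset (G.incidenceSet_subset_edgeSet x))
  omega

open Classical in
-- The uncoloured edge contributes to the degree but uses no colour, which yields the second missing
-- colour.
lemma two_le_card_missing (hE : G.edgeSet.Finite) {x : α} (hx : (G.incidenceSet x).ncard < k)
    {e₀ : β} (he₀ : G.Inc e₀ x) (hφ : φ e₀ = none) :
    2 ≤ (Finset.univ.filter fun c => Missing G φ c x).card := by
  have h1 := le_card_missing_add (φ := φ) hE x
  have h2 : {e | G.Inc e x ∧ φ e ≠ none}.ncard < (G.incidenceSet x).ncard :=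
    Set.ncard_lt_ncard ⟨fun e he => he.1, fun h => (h he₀).2 hφ⟩
      (hE.subset (G.incidenceSet_subset_edgeSet x))
  omega

lemma exists_missing (hE : G.edgeSet.Finite) {x : α} (hx : (G.incidenceSet x).ncard < k) :
    ∃ c, Missing G φ c x := by
  classical
  obtain ⟨c, hc⟩ := Finset.card_pos.1 (one_le_card_missing (φ := φ) hE hx)
  exact ⟨c, (Finset.mem_filter.1 hc).2⟩

/-- An elementary set containing both ends of an uncoloured edge misses many colours. -/
lemma exists_missing_not_mem (hE : G.edgeSet.Finite)
    (hdeg : ∀ x ∈ G.vertexSet, (G.incidenceSet x).ncard < k) {S : Finset α}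
    (hS : ∀ x ∈ S, x ∈ G.vertexSet) (hel : IsElementary G φ S) {e₀ : β} (hφ : φ e₀ = none)
    {x₀ x₁ : α} (hne : x₀ ≠ x₁) (h0 : x₀ ∈ S) (h1 : x₁ ∈ S) (hi0 : G.Inc e₀ x₀)
    (hi1 : G.Inc e₀ x₁) {U : Finset (Fin k)} (hU : U.card ≤ S.card + 1) :
    ∃ c ∉ U, ∃ x ∈ S, Missing G φ c x := by
  classical
  let M : α → Finset (Fin k) := fun x => Finset.univ.filter fun c => Missing G φ c x
  have hdisj : ∀ x ∈ S, ∀ y ∈ S, x ≠ y → Disjoint (M x) (M y) := by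
    intro x hx y hy hxy
    rw [Finset.disjoint_left]
    intro c hcx hcy
    exact hel x hx y hy hxy c ⟨(Finset.mem_filter.1 hcx).2, (Finset.mem_filter.1 hcy).2⟩
  -- The sets of missing colours are disjoint and nonempty, and those at the two ends of `e₀` have
  -- at least two elements.
  have hcard : S.card + 2 ≤ (S.biUnion M).card := by
    rw [Finset.card_biUnion hdisj]
    have hsum : ∑ x ∈ S, (1 + if x ∈ ({x₀, x₁} : Finset α) then 1 else 0) = S.card + 2 := by
      rw [Finset.sum_add_distrib, Finset.sum_const, smul_eq_mul, mul_one, Finset.sum_ite_mem,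
        Finset.sum_const, smul_eq_mul, mul_one, Finset.inter_eq_right.2, Finset.card_pair hne]
      intro x hx
      simp only [Finset.mem_insert, Finset.mem_singleton] at hx
      rcases hx with rfl | rfl <;> assumption
    rw [← hsum]
    refine Finset.sum_le_sum fun x hx => ?_
    split_ifs with h
    · simp only [Finset.mem_insert, Finset.mem_singleton] at h
      refine two_le_card_missing hE (hdeg x (hS x hx)) (e₀ := e₀) ?_ hφ
      rcases h with rfl | rfl <;> assumption
    · exact one_le_card_missing hE (hdeg x (hS x hx))
  obtain ⟨c, hc, hcU⟩ := Finset.exists_mem_notMem_of_card_lt_card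
    (show U.card < (S.biUnion M).card by omega)
  obtain ⟨x, hx, hcx⟩ := Finset.mem_biUnion.1 hc
  exact ⟨c, hcU, x, hx, (Finset.mem_filter.1 hcx).2⟩

end Counting

/-! ### Kempe-closed classes and numbered Tashkinov trees -/

section Sequences

variable {α β : Type*} {k : ℕ}

/-- A class of partial colourings, closed under Kempe changes, of a finite graph whose degrees are
less than the number of colours, such that in no colouring of the class the ends of the uncoloured
edge `e₀` have a common missing colour. -/
structure KempeClass (G : Graph α β) (e₀ : β) (R : (β → Option (Fin k)) → Prop) : Prop where
  loopless : G.Loopless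
  finite_vertexSet : G.vertexSet.Finite
  finite_edgeSet : G.edgeSet.Finite
  degree_lt : ∀ x ∈ G.vertexSet, (G.incidenceSet x).ncard < k
  colouring : ∀ ψ, R ψ → IsPartialColouring G ψ
  uncoloured : ∀ ψ, R ψ → ψ e₀ = none
  switch : ∀ ψ a b x, R ψ → a ≠ b → x ∈ G.vertexSet → R (kempeSwitch G ψ a b x)
  ends : ∀ ψ, R ψ → ¬ ∃ c, ∀ x, G.Inc e₀ x → Missing G ψ c x

/-- The vertices `y 0, …, y n` and the edges `e 1 = e₀, …, e n` form a Tashkinov tree, listed in an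
order in which it can be grown. -/
structure IsTashkinovSeq (G : Graph α β) (φ : β → Option (Fin k)) (e₀ : β) (n : ℕ) (y : ℕ → α)
    (e : ℕ → β) : Prop where
  one_le : 1 ≤ n
  inj : ∀ i ≤ n, ∀ j ≤ n, y i = y j → i = j
  first : e 1 = e₀
  isLink : ∀ j, 1 ≤ j → j ≤ n → ∃ l < j, G.IsLink (e j) (y l) (y j)
  colour : ∀ j, 2 ≤ j → j ≤ n → ∃ c, φ (e j) = some c ∧ ∃ m < j, Missing G φ c (y m)

/-- From `y p` on, the tree is a path. -/
def HasPathTail (G : Graph α β) (p n : ℕ) (y : ℕ → α) (e : ℕ → β) : Prop :=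
  ∀ j, 1 ≤ j → p < j → j ≤ n → G.IsLink (e j) (y (j - 1)) (y j)

/-- The vertices `y 0, …, y n` form an elementary set. -/
def SeqElementary (G : Graph α β) (φ : β → Option (Fin k)) (n : ℕ) (y : ℕ → α) : Prop :=
  ∀ i ≤ n, ∀ j ≤ n, ∀ c, Missing G φ c (y i) → Missing G φ c (y j) → i = j

/-- The colour `c` is not used on the edges `e 2, …, e r`. -/
def UnusedUpTo (φ : β → Option (Fin k)) (c : Fin k) (r : ℕ) (e : ℕ → β) : Prop :=
  ∀ l, 2 ≤ l → l ≤ r → φ (e l) ≠ some c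

/-- All Tashkinov trees on `n + 1` vertices with a path tail from `y p` on are elementary. -/
def AllElementary (G : Graph α β) (e₀ : β) (R : (β → Option (Fin k)) → Prop) (p n : ℕ) : Prop :=
  ∀ ψ, R ψ → ∀ y e, IsTashkinovSeq G ψ e₀ n y e → HasPathTail G p n y e → SeqElementary G ψ n y

variable {G : Graph α β} {φ ψ : β → Option (Fin k)} {e₀ : β} {n p r i j : ℕ} {y : ℕ → α}
  {e : ℕ → β} {a b c : Fin k} {R : (β → Option (Fin k)) → Prop}

lemma SeqElementary.mono (h : SeqElementary G φ n y) (hr : r ≤ n) : SeqElementary G φ r y :=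
  fun i hi j hj => h i (hi.trans hr) j (hj.trans hr)

lemma UnusedUpTo.mono (h : UnusedUpTo φ c n e) (hr : r ≤ n) : UnusedUpTo φ c r e :=
  fun l hl hlr => h l hl (hlr.trans hr)

namespace IsTashkinovSeq

lemma mono (h : IsTashkinovSeq G φ e₀ n y e) (hr1 : 1 ≤ r) (hr : r ≤ n) :
    IsTashkinovSeq G φ e₀ r y e where
  one_le := hr1
  inj i hi j hj := h.inj i (hi.trans hr) j (hj.trans hr)
  first := h.first
  isLink j hj hjr := h.isLink j hj (hjr.trans hr)
  colour j hj hjr := h.colour j hj (hjr.trans hr)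

lemma isLink_first (h : IsTashkinovSeq G φ e₀ n y e) : G.IsLink e₀ (y 0) (y 1) := by
  obtain ⟨l, hl, h1⟩ := h.isLink 1 le_rfl h.one_le
  obtain rfl : l = 0 := by omega
  rwa [h.first] at h1

lemma mem_vertexSet (h : IsTashkinovSeq G φ e₀ n y e) (hi : i ≤ n) : y i ∈ G.vertexSet := by
  rcases Nat.eq_zero_or_pos i with rfl | hi0
  · exact h.isLink_first.left_mem
  · obtain ⟨l, _, h1⟩ := h.isLink i hi0 hi
    exact h1.right_mem

/-- A colour on an edge of an elementary tree is missing at an earlier vertex. -/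
lemma lt_of_colour (h : IsTashkinovSeq G φ e₀ n y e) (hel : SeqElementary G φ (n - 1) y)
    (hi : i < n) (ha : Missing G φ a (y i)) {l : ℕ} (hl : 2 ≤ l) (hln : l ≤ n)
    (hc : φ (e l) = some a) : i < l := by
  obtain ⟨c, hc', m, hm, hmc⟩ := h.colour l hl hln
  rw [hc, Option.some.injEq] at hc'
  subst hc'
  rw [hel i (by omega) m (by omega) a ha hmc]
  exact hm

/-- Missing sets at other tree vertices may change, but `y i` and `y j` keep `a` and `b` and so can
justify every tree edge of colour `a` or `b` that comes after them. -/
lemma kempeSwitch (h : IsTashkinovSeq G φ e₀ n y e) {x : α} (ha : Missing G φ a (y i))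
    (hb : Missing G φ b (y j)) (hxi : ¬ SameComponent G φ a b x (y i))
    (hxj : ¬ SameComponent G φ a b x (y j))
    (hea : ∀ l, 2 ≤ l → l ≤ n → kempeSwitch G φ a b x (e l) = some a → i < l)
    (heb : ∀ l, 2 ≤ l → l ≤ n → kempeSwitch G φ a b x (e l) = some b → j < l) :
    IsTashkinovSeq G (kempeSwitch G φ a b x) e₀ n y e where
  one_le := h.one_le
  inj := h.inj
  first := h.first
  isLink := h.isLink
  colour l hl hln := by
    obtain ⟨c, hc, m, hm, hmc⟩ := h.colour l hl hln
    by_cases hab : φ (e l) = some a ∨ φ (e l) = some b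
    · rw [← kempeSwitch_mem_pair_iff (G := G) (x := x)] at hab
      rcases hab with hab | hab
      · exact ⟨a, hab, i, hea l hl hln hab, (missing_kempeSwitch_of_not_mem hxi).2 ha⟩
      · exact ⟨b, hab, j, heb l hl hln hab, (missing_kempeSwitch_of_not_mem hxj).2 hb⟩
    · rw [hc, Option.some.injEq, Option.some.injEq, not_or] at hab
      exact ⟨c, (kempeSwitch_eq_some_iff_of_ne hab.1 hab.2).2 hc, m, hm,
        (missing_kempeSwitch_of_ne hab.1 hab.2).2 hmc⟩

end IsTashkinovSeq

/-- The `q + 1` elementary vertices miss at least `q + 3` colours, while `e 2, …, e r` carry at most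
`q + 1`; the edge `e 1 = e₀` carries none. -/
lemma exists_unused (hR : KempeClass G e₀ R) (hψ : R ψ) (h : IsTashkinovSeq G ψ e₀ n y e) {q : ℕ}
    (hq : 1 ≤ q) (hqn : q ≤ n) (hel : SeqElementary G ψ q y) (hr : r ≤ q + 2) :
    ∃ c, ∃ j ≤ q, Missing G ψ c (y j) ∧ UnusedUpTo ψ c r e := by
  classical
  let S : Finset α := (Finset.range (q + 1)).image y
  have hmem : ∀ i ≤ q, y i ∈ S := fun i hi =>
    Finset.mem_image_of_mem _ (Finset.mem_range.2 (by omega))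
  have hS : S.card = q + 1 := by
    rw [Finset.card_image_of_injOn, Finset.card_range]
    intro i hi j hj hij
    simp only [Finset.coe_range, Set.mem_Iio] at hi hj
    exact h.inj i (by omega) j (by omega) hij
  let U : Finset (Fin k) :=
    Finset.univ.filter fun c => ∃ l, (2 ≤ l ∧ l ≤ r) ∧ ψ (e l) = some c
  have hU : U.card ≤ q + 1 := by
    have : U.image some ⊆ (Finset.Icc 2 r).image fun l => ψ (e l) := by
      intro o ho
      obtain ⟨c, hc, rfl⟩ := Finset.mem_image.1 ho
      obtain ⟨l, hl, hlc⟩ := (Finset.mem_filter.1 hc).2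
      exact Finset.mem_image.2 ⟨l, Finset.mem_Icc.2 hl, hlc⟩
    have := (Finset.card_le_card this).trans Finset.card_image_le
    rw [Finset.card_image_of_injective _ (Option.some_injective _), Nat.card_Icc] at this
    omega
  obtain ⟨c, hcU, x, hx, hcx⟩ := exists_missing_not_mem hR.finite_edgeSet hR.degree_lt (S := S)
    (φ := ψ) (U := U) (x₀ := y 0) (x₁ := y 1) (e₀ := e₀)
    (by
      intro x hx
      obtain ⟨i, hi, rfl⟩ := Finset.mem_image.1 hx
      exact h.mem_vertexSet (by have := Finset.mem_range.1 hi; omega))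
    (by
      intro x hx z hz hxz d hd
      obtain ⟨i, hi, rfl⟩ := Finset.mem_image.1 (Finset.mem_coe.1 hx)
      obtain ⟨j, hj, rfl⟩ := Finset.mem_image.1 (Finset.mem_coe.1 hz)
      rw [Finset.mem_range] at hi hj
      exact hxz (by rw [hel i (by omega) j (by omega) d hd.1 hd.2]))
    (hR.uncoloured ψ hψ)
    (fun h01 => by have := h.inj 0 (by omega) 1 h.one_le h01; omega)
    (hmem 0 (by omega)) (hmem 1 hq) h.isLink_first.inc_left h.isLink_first.inc_right
    (by omega)
  obtain ⟨j, hj, rfl⟩ := Finset.mem_image.1 hx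
  refine ⟨c, j, by have := Finset.mem_range.1 hj; omega, hcx, fun l hl hlr hlc => hcU ?_⟩
  exact Finset.mem_filter.2 ⟨Finset.mem_univ _, l, ⟨hl, hlr⟩, hlc⟩

/-- The hypothesis that all proper initial segments of a given tree are elementary with respect to
all colourings of the class. -/
def InitialElementary (G : Graph α β) (e₀ : β) (R : (β → Option (Fin k)) → Prop) (n : ℕ)
    (y : ℕ → α) (e : ℕ → β) : Prop :=
  ∀ ψ, R ψ → ∀ r < n, IsTashkinovSeq G ψ e₀ r y e → SeqElementary G ψ r y

lemma InitialElementary.pred (H : InitialElementary G e₀ R n y e) (hψ : R ψ)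
    (h : IsTashkinovSeq G ψ e₀ n y e) (hr : r < n) : SeqElementary G ψ r y := by
  rcases Nat.eq_zero_or_pos r with rfl | h0
  · intro i hi j hj _ _ _
    omega
  · exact H ψ hψ r hr (h.mono h0 hr.le)

end Sequences

end EdgeColouring

namespace EdgeColouring

/-! ### Exchanging a colour missing at the last vertex -/

section Exchange

variable {α β : Type*} {k : ℕ} {G : Graph α β} {φ ψ : β → Option (Fin k)} {e₀ : β}
  {n p r i j : ℕ} {y : ℕ → α} {e : ℕ → β} {a b c : Fin k} {R : (β → Option (Fin k)) → Prop}

namespace KempeClass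

lemma eq_or_eq_or_eq (hR : KempeClass G e₀ R) (hψ : R ψ) {x y z : α}
    (hx : Missing G ψ a x ∨ Missing G ψ b x)
    (hy : Missing G ψ a y ∨ Missing G ψ b y) (hz : Missing G ψ a z ∨ Missing G ψ b z)
    (hxy : SameComponent G ψ a b x y) (hxz : SameComponent G ψ a b x z) :
    x = y ∨ x = z ∨ y = z :=
  have : Nonempty β := ⟨e₀⟩
  have := hR.loopless
  eq_or_eq_or_eq_of_sameComponent hR.finite_vertexSet (hR.colouring ψ hψ) hx hy hz hxy hxz

lemma exists_missing (hR : KempeClass G e₀ R) {x : α} (hx : x ∈ G.vertexSet) :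
    ∃ c, Missing G φ c x :=
  EdgeColouring.exists_missing hR.finite_edgeSet (hR.degree_lt x hx)

end KempeClass

/-- Two colours missing in an initial segment, and unused on it, are linked by a chain. -/
lemma InitialElementary.sameComponent (H : InitialElementary G e₀ R n y e)
    (hR : KempeClass G e₀ R) (hψ : R ψ) (h : IsTashkinovSeq G ψ e₀ n y e) (hr : r < n)
    (hr1 : 1 ≤ r) (hi : i ≤ r) (hj : j ≤ r) (hij : i ≠ j) (hab : a ≠ b)
    (ha : Missing G ψ a (y i)) (hb : Missing G ψ b (y j)) (hua : UnusedUpTo ψ a r e)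
    (hub : UnusedUpTo ψ b r e) : SameComponent G ψ a b (y i) (y j) := by
  by_contra hns
  have hR' := hR.switch ψ a b (y i) hψ hab (h.mem_vertexSet (by omega))
  have hseq : IsTashkinovSeq G (kempeSwitch G ψ a b (y i)) e₀ r y e :=
    ⟨hr1, (h.mono hr1 hr.le).inj, h.first, (h.mono hr1 hr.le).isLink, by
      intro l hl hlr
      obtain ⟨c, hc, m, hm, hmc⟩ := h.colour l hl (by omega)
      have hca : c ≠ a := fun hca => hua l hl hlr (hca ▸ hc)
      have hcb : c ≠ b := fun hcb => hub l hl hlr (hcb ▸ hc)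
      exact ⟨c, (kempeSwitch_eq_some_iff_of_ne hca hcb).2 hc, m, hm,
        (missing_kempeSwitch_of_ne hca hcb).2 hmc⟩⟩
  exact hij (H _ hR' r hr hseq i hi j hj b ((missing_kempeSwitch_right sameComponent_self).2 ha)
    ((missing_kempeSwitch_of_not_mem hns).2 hb))

/-- The component joining `y i` to `y j` already has its two ends, so `y n` would be a third vertex
in it missing one of the colours. For `i = j` the component is a single vertex. -/
lemma InitialElementary.not_sameComponent (H : InitialElementary G e₀ R n y e)
    (hR : KempeClass G e₀ R) (hψ : R ψ) (h : IsTashkinovSeq G ψ e₀ n y e) (hr : r < n)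
    (hr1 : 1 ≤ r) (hi : i ≤ r) (hj : j ≤ r) (hab : a ≠ b)
    (ha : Missing G ψ a (y i)) (hb : Missing G ψ b (y j)) (hua : UnusedUpTo ψ a r e)
    (hub : UnusedUpTo ψ b r e) (hn : Missing G ψ a (y n)) :
    ¬ SameComponent G ψ a b (y n) (y i) ∧ ¬ SameComponent G ψ a b (y n) (y j) := by
  have hni : ∀ l ≤ r, y n ≠ y l := fun l hl hl' => by
    have := h.inj n le_rfl l (by omega) hl'; omega
  rcases eq_or_ne i j with rfl | hij
  · have : ¬ SameComponent G ψ a b (y n) (y i) := fun hs =>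
      hni i hi (hs.symm.eq_of_missing ha hb)
    exact ⟨this, this⟩
  · have hs := H.sameComponent hR hψ h hr hr1 hi hj hij hab ha hb hua hub
    have key : ¬ SameComponent G ψ a b (y n) (y i) := by
      intro hs'
      rcases hR.eq_or_eq_or_eq hψ (Or.inl hn) (Or.inl ha) (Or.inr hb) hs' (hs'.trans hs)
        with h1 | h1 | h1
      · exact hni i hi h1
      · exact hni j hj h1
      · exact hij (h.inj i (by omega) j (by omega) h1)
    exact ⟨key, fun hs' => key (hs'.trans hs.symm)⟩

/-- A colour missing at the last vertex of the tree can be exchanged, by switching the chain from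
this vertex, provided that both colours are missing in an initial segment and unused on it. -/
lemma InitialElementary.exchange (H : InitialElementary G e₀ R n y e)
    (hR : KempeClass G e₀ R) (hψ : R ψ) (h : IsTashkinovSeq G ψ e₀ n y e) (hr : r < n)
    (hr1 : 1 ≤ r) (hi : i ≤ r) (hj : j ≤ r) (hab : a ≠ b)
    (ha : Missing G ψ a (y i)) (hb : Missing G ψ b (y j)) (hua : UnusedUpTo ψ a r e)
    (hub : UnusedUpTo ψ b r e) (hn : Missing G ψ a (y n)) :
    ∃ ψ', R ψ' ∧ IsTashkinovSeq G ψ' e₀ n y e ∧ Missing G ψ' b (y n) ∧ Missing G ψ' a (y i) ∧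
      Missing G ψ' b (y j) ∧
      (∀ c, c ≠ a → c ≠ b → ∀ x, Missing G ψ' c x ↔ Missing G ψ c x) ∧
      (∀ c, c ≠ a → c ≠ b → ∀ f, ψ' f = some c ↔ ψ f = some c) ∧
      (∀ f, (ψ' f = some a ∨ ψ' f = some b) ↔ (ψ f = some a ∨ ψ f = some b)) := by
  obtain ⟨hni, hnj⟩ := H.not_sameComponent hR hψ h hr hr1 hi hj hab ha hb hua hub hn
  have hlt : ∀ l, 2 ≤ l → (ψ (e l) = some a ∨ ψ (e l) = some b) → r < l := by
    intro l hl hc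
    by_contra! hlr
    rcases hc with hc | hc
    · exact hua l hl hlr hc
    · exact hub l hl hlr hc
  refine ⟨kempeSwitch G ψ a b (y n), hR.switch ψ a b _ hψ hab (h.mem_vertexSet le_rfl),
    h.kempeSwitch ha hb hni hnj ?_ ?_, (missing_kempeSwitch_right sameComponent_self).2 hn,
    (missing_kempeSwitch_of_not_mem hni).2 ha, (missing_kempeSwitch_of_not_mem hnj).2 hb,
    fun c hca hcb x => missing_kempeSwitch_of_ne hca hcb,
    fun c hca hcb x => kempeSwitch_eq_some_iff_of_ne hca hcb,
    fun f => kempeSwitch_mem_pair_iff⟩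
  · intro l hl _ hc
    have := hlt l hl (kempeSwitch_mem_pair_iff.1 (Or.inl hc)); omega
  · intro l hl _ hc
    have := hlt l hl (kempeSwitch_mem_pair_iff.1 (Or.inr hc)); omega

lemma SeqElementary.ne (hel : SeqElementary G ψ n y) (hi : i ≤ n) (hj : j ≤ n) (hij : i ≠ j)
    (ha : Missing G ψ a (y i)) (hb : Missing G ψ b (y j)) : a ≠ b := by
  rintro rfl
  exact hij (hel i hi j hj a ha hb)

/-- If the last edge joins the last two vertices, then these have no common missing colour. -/
lemma InitialElementary.false_of_missing_pred (H : InitialElementary G e₀ R n y e)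
    (hR : KempeClass G e₀ R) (hψ : R ψ) (h : IsTashkinovSeq G ψ e₀ n y e)
    (hlink : G.IsLink (e n) (y (n - 1)) (y n)) (ha : Missing G ψ a (y (n - 1)))
    (hn : Missing G ψ a (y n)) : False := by
  have hn1 := h.one_le
  rcases hn1.eq_or_lt with rfl | hn2
  · refine hR.ends ψ hψ ⟨a, fun x hx => ?_⟩
    rcases hx.eq_or_eq_of_isLink h.isLink_first with rfl | rfl
    · exact ha
    · exact hn
  · obtain ⟨c, hc, m, hm, hmc⟩ := h.colour n hn2 le_rfl
    have hca : c ≠ a := by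
      rintro rfl
      exact hn _ hlink.inc_right hc
    have hmn : m ≠ n - 1 := by
      rintro rfl
      exact hmc _ hlink.inc_left hc
    have hφ := hR.colouring ψ hψ
    -- Both ends of `e n` miss `a`, so this edge alone is a component. Switching it leaves the
    -- vertices before `y (n - 1)` untouched and makes `y (n - 1)` miss `c`, as `y m` does, in a
    -- shorter tree.
    have hcomp : ∀ z, SameComponent G ψ c a (y n) z → z = y n ∨ z = y (n - 1) := fun z hz =>
      eq_or_eq_of_sameComponent_edge hφ hlink.symm hc hn ha hz
    have hnot : ∀ l, l < n - 1 → ¬ SameComponent G ψ c a (y n) (y l) := by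
      intro l hl hs
      rcases hcomp _ hs with h1 | h1
      · have := h.inj l (by omega) n le_rfl h1; omega
      · have := h.inj l (by omega) (n - 1) (by omega) h1; omega
    have hseq : IsTashkinovSeq G (EdgeColouring.kempeSwitch G ψ c a (y n)) e₀ (n - 1) y e :=
      ⟨by omega, (h.mono (by omega) (Nat.sub_le n 1)).inj, h.first,
        (h.mono (by omega) (Nat.sub_le n 1)).isLink, by
        intro l hl hln
        obtain ⟨d, hd, q, hq, hqd⟩ := h.colour l hl (by omega)
        obtain ⟨t, ht, htl⟩ := h.isLink l (by omega) (by omega)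
        exact ⟨d, (kempeSwitch_of_not_mem htl.inc_left (hnot t (by omega))).trans hd, q, hq,
          (missing_kempeSwitch_of_not_mem (hnot q (by omega))).2 hqd⟩⟩
    refine hmn (H _ (hR.switch ψ c a _ hψ hca (h.mem_vertexSet le_rfl)) (n - 1) (by omega) hseq
      m (by omega) (n - 1) le_rfl c ?_ ?_)
    · exact (missing_kempeSwitch_of_not_mem (hnot m (by omega))).2 hmc
    · exact (missing_kempeSwitch_left
        (sameComponent_of_isLink hlink.symm (Or.inl hc))).2 ha

lemma InitialElementary.unusedUpTo (H : InitialElementary G e₀ R n y e) (hψ : R ψ)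
    (h : IsTashkinovSeq G ψ e₀ n y e) (hi : i < n) (ha : Missing G ψ a (y i)) :
    UnusedUpTo ψ a i e := by
  intro l hl hli hc
  have := h.lt_of_colour (H.pred hψ h (Nat.sub_lt h.one_le one_pos)) hi ha hl (by omega) hc
  omega

/-- The last vertex has no missing colour in common with another vertex of the path tail. -/
lemma InitialElementary.false_of_missing_tail (H : InitialElementary G e₀ R n y e)
    (hR : KempeClass G e₀ R) (htail : HasPathTail G p n y e) (hi : p ≤ i) (hin : i < n) :
    ∀ ψ a, R ψ → IsTashkinovSeq G ψ e₀ n y e → Missing G ψ a (y i) → Missing G ψ a (y n) →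
      False := by
  -- Induction on the distance from `y i` to `y (n - 1)` along the tail.
  obtain ⟨d, hd⟩ : ∃ d, n = i + 1 + d := ⟨n - i - 1, by omega⟩
  induction d generalizing i with
  | zero =>
    intro ψ a hψ h ha hn
    obtain rfl : i = n - 1 := by omega
    exact H.false_of_missing_pred hR hψ h (htail n h.one_le (by omega) le_rfl) ha hn
  | succ d ih =>
    intro ψ a hψ h ha hn
    -- Exchanging `a` for a colour `b` missing at the next vertex `y (i + 1)` moves the coincidence
    -- one step closer to `y n`.
    obtain ⟨b, hb⟩ := hR.exists_missing (φ := ψ) (h.mem_vertexSet (i := i + 1) (by omega))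
    have hel := H.pred hψ h (Nat.sub_lt h.one_le one_pos)
    have hab : a ≠ b := hel.ne (i := i) (j := i + 1) (by omega) (by omega) (by omega) ha hb
    -- The only edge of concern is `e (i + 1)`; it is incident with `y i`, which misses `a`.
    have hua : UnusedUpTo ψ a (i + 1) e := by
      intro l hl hli hc
      have := h.lt_of_colour hel hin ha hl (by omega) hc
      obtain rfl : l = i + 1 := by omega
      exact ha _ (htail (i + 1) (by omega) (by omega) (by omega)).inc_left hc
    obtain ⟨ψ', hψ', h', hn', -, hb', -⟩ := H.exchange hR hψ h (r := i + 1) (i := i) (j := i + 1)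
      (by omega) (by omega) (by omega) le_rfl hab ha hb hua
      (H.unusedUpTo hψ h (by omega) hb) hn
    exact ih (by omega) (by omega) (by omega) ψ' b hψ' h' hb' hn'

/-- An exchange of `a` for a colour missing at `y p` moves the coincidence into the path tail. -/
lemma InitialElementary.false_of_unused (H : InitialElementary G e₀ R n y e)
    (hR : KempeClass G e₀ R) (hψ : R ψ) (h : IsTashkinovSeq G ψ e₀ n y e)
    (htail : HasPathTail G p n y e) (hi : i < p) (hpn : p < n) (ha : Missing G ψ a (y i))
    (hn : Missing G ψ a (y n)) (hua : UnusedUpTo ψ a p e) : False := by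
  obtain ⟨b, hb⟩ := hR.exists_missing (φ := ψ) (h.mem_vertexSet (i := p) (by omega))
  have hel := H.pred hψ h hpn
  have hab : a ≠ b := hel.ne hi.le le_rfl hi.ne ha hb
  obtain ⟨ψ', hψ', h', hn', -, hb', -⟩ := H.exchange hR hψ h (r := p) (i := i) (j := p)
    hpn (by omega) hi.le le_rfl hab ha hb hua (H.unusedUpTo hψ h hpn hb) hn
  exact H.false_of_missing_tail hR htail le_rfl hpn ψ' b hψ' h' hb' hn'

end Exchange

end EdgeColouring

namespace EdgeColouring

/-! ### Tashkinov's theorem -/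

section Tashkinov

variable {α β : Type*} {k : ℕ} {G : Graph α β} {φ ψ : β → Option (Fin k)} {e₀ : β}
  {n p q r i j : ℕ} {y : ℕ → α} {e : ℕ → β} {a b c : Fin k} {R : (β → Option (Fin k)) → Prop}

/-- An initial segment can be extended along an alternating chain in two of its missing colours;
if the chain starts at a vertex missing one of them, the resulting tree is not elementary. -/
lemma IsTashkinovSeq.false_of_chain (h : IsTashkinovSeq G ψ e₀ q y e) (hψ : R ψ)
    (H : ∀ n', AllElementary G e₀ R (q + 1) n') (hi : i ≤ q) (hj : j ≤ q)
    (ha : Missing G ψ a (y i)) (hb : Missing G ψ b (y j)) {m : ℕ} {f : ℕ → α} {g : ℕ → β}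
    (hc : IsChain G ψ a b m f g) (h0 : Missing G ψ a (f 0)) (hf0 : ∀ l ≤ q, f 0 ≠ y l)
    (hit : ∃ s ≤ m, ∃ l ≤ q, f s = y l) : False := by
  classical
  -- The chain is cut at its first vertex `f s` on the segment; the earlier vertices are new.
  obtain ⟨hsm, l₀, hl₀, hfs⟩ := Nat.find_spec hit
  have hmin : ∀ t, t < Nat.find hit → ∀ l ≤ q, f t ≠ y l := by
    intro t ht l hl hfl
    exact Nat.find_min hit ht ⟨by omega, l, hl, hfl⟩
  set s := Nat.find hit with hs
  have hs0 : 0 < s := by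
    rcases Nat.eq_zero_or_pos s with h0 | h0
    · rw [h0] at hfs
      exact (hf0 l₀ hl₀ hfs).elim
    · exact h0
  -- The cut chain is appended backwards: position `q + r` holds `f (s - r)`, so the tree ends with
  -- `f 0` at position `q + s`.
  let y' : ℕ → α := fun l => if l ≤ q then y l else f (s - (l - q))
  let e' : ℕ → β := fun l => if l ≤ q then e l else g (s - (l - q))
  have hy : ∀ l ≤ q, y' l = y l := fun l hl => if_pos hl
  have he : ∀ l ≤ q, e' l = e l := fun l hl => if_pos hl
  have hy' : ∀ l, q < l → y' l = f (s - (l - q)) := fun l hl => if_neg (by omega)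
  have he' : ∀ l, q < l → e' l = g (s - (l - q)) := fun l hl => if_neg (by omega)
  have hlink : ∀ l, q < l → l ≤ q + s → G.IsLink (e' l) (f (s - (l - q) + 1)) (y' l) := by
    intro l hl hls
    rw [hy' l hl, he' l hl]
    exact (hc.isLink _ (by omega)).symm
  have hprev : ∀ l, q + 1 < l → l ≤ q + s → y' (l - 1) = f (s - (l - q) + 1) := by
    intro l hl hls
    rw [hy' _ (by omega)]
    congr 1
    omega
  have hseq : IsTashkinovSeq G ψ e₀ (q + s) y' e' := by
    have hq := h.one_le
    refine ⟨by omega, ?_, (he 1 hq).trans h.first, ?_, ?_⟩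
    · intro u hu v hv huv
      rcases le_or_gt u q with h1 | h1 <;> rcases le_or_gt v q with h2 | h2
      · rw [hy u h1, hy v h2] at huv
        exact h.inj u h1 v h2 huv
      · rw [hy u h1, hy' v h2] at huv
        exact (hmin _ (by omega) u h1 huv.symm).elim
      · rw [hy' u h1, hy v h2] at huv
        exact (hmin _ (by omega) v h2 huv).elim
      · rw [hy' u h1, hy' v h2] at huv
        have := hc.inj _ (by omega) _ (by omega) huv
        omega
    · intro l hl hls
      rcases le_or_gt l q with h1 | h1
      · obtain ⟨t, ht, hlt⟩ := h.isLink l hl h1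
        refine ⟨t, ht, ?_⟩
        rwa [he l h1, hy l h1, hy t (by omega)]
      · rcases Nat.lt_or_ge (q + 1) l with h2 | h2
        · refine ⟨l - 1, by omega, ?_⟩
          rw [hprev l h2 hls]
          exact hlink l h1 hls
        · obtain rfl : l = q + 1 := by omega
          refine ⟨l₀, by omega, ?_⟩
          rw [hy l₀ hl₀, ← hfs]
          have := hlink (q + 1) h1 hls
          rwa [show s - (q + 1 - q) + 1 = s by omega] at this
    · intro l hl hls
      rcases le_or_gt l q with h1 | h1
      · obtain ⟨d, hd, t, ht, htd⟩ := h.colour l hl h1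
        refine ⟨d, by rwa [he l h1], t, ht, ?_⟩
        rwa [hy t (by omega)]
      · rw [he' l h1]
        rcases hc.colour (s - (l - q)) (by omega) with hd | hd
        · exact ⟨a, hd, i, by omega, by rwa [hy i hi]⟩
        · exact ⟨b, hd, j, by omega, by rwa [hy j hj]⟩
  have htail : HasPathTail G (q + 1) (q + s) y' e' := by
    intro l _ hl hls
    rw [hprev l hl hls]
    exact hlink l (by omega) hls
  have := H _ ψ hψ y' e' hseq htail i (by omega) (q + s) le_rfl a (by rwa [hy i hi])
    (by rwa [hy' _ (by omega), show s - (q + s - q) = 0 by omega])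
  omega

/-- If the last edge is not attached to the vertex before the last one and its colour is missing
before that vertex, then the last vertex has no missing colour in common with the vertices before
that vertex. -/
lemma IsTashkinovSeq.false_of_skip (h : IsTashkinovSeq G ψ e₀ n y e) (hψ : R ψ)
    (H : AllElementary G e₀ R (n - 1) (n - 1)) {t m : ℕ} (ht : t + 2 ≤ n)
    (hlink : G.IsLink (e n) (y t) (y n)) (hc : ψ (e n) = some c) (hm : m + 2 ≤ n)
    (hmc : Missing G ψ c (y m)) (hi : i + 2 ≤ n) (ha : Missing G ψ a (y i))
    (hn : Missing G ψ a (y n)) (hn3 : 3 ≤ n) : False := by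
  -- The renumbering drops `y (n - 1)` and puts `y n` in its place. This is still a tree since `t`
  -- and `m` are at most `n - 2`.
  let s : ℕ → ℕ := fun l => if l = n - 1 then n else l
  have hs : ∀ l, l ≠ n - 1 → s l = l := fun l hl => if_neg hl
  have hs' : s (n - 1) = n := if_pos rfl
  have hseq : IsTashkinovSeq G ψ e₀ (n - 1) (y ∘ s) (e ∘ s) := by
    refine ⟨by omega, ?_, ?_, ?_, ?_⟩
    · intro u hu v hv huv
      have h1 : s u ≤ n := by dsimp only [s]; split_ifs <;> omega
      have h2 : s v ≤ n := by dsimp only [s]; split_ifs <;> omega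
      have := h.inj _ h1 _ h2 huv
      dsimp only [s] at this
      split_ifs at this <;> omega
    · rw [Function.comp_apply, hs 1 (by omega), h.first]
    · intro l hl hln
      rcases eq_or_ne l (n - 1) with rfl | hne
      · refine ⟨t, by omega, ?_⟩
        rwa [Function.comp_apply, Function.comp_apply, Function.comp_apply, hs', hs t (by omega)]
      · obtain ⟨u, hu, hlu⟩ := h.isLink l hl (by omega)
        refine ⟨u, hu, ?_⟩
        rwa [Function.comp_apply, Function.comp_apply, Function.comp_apply, hs l hne,
          hs u (by omega)]
    · intro l hl hln
      rcases eq_or_ne l (n - 1) with rfl | hne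
      · refine ⟨c, ?_, m, by omega, ?_⟩
        · rwa [Function.comp_apply, hs']
        · rwa [Function.comp_apply, hs m (by omega)]
      · obtain ⟨d, hd, u, hu, hdu⟩ := h.colour l hl (by omega)
        refine ⟨d, ?_, u, hu, ?_⟩
        · rwa [Function.comp_apply, hs l hne]
        · rwa [Function.comp_apply, hs u (by omega)]
  have := H ψ hψ _ _ hseq (fun l _ hl hln => by omega) i (by omega) (n - 1) le_rfl a
    (by rwa [Function.comp_apply, hs i (by omega)]) (by rwa [Function.comp_apply, hs'])
  omega

/-- The colour missing at the last vertex may be assumed to be missing before the branching vertex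
`y (p - 1)` and to be unused up to `y p`. -/
lemma InitialElementary.exists_unused_common (H : InitialElementary G e₀ R n y e)
    (hR : KempeClass G e₀ R) (hp : 3 ≤ p) (hpn : p ≤ n)
    (IH : ∀ n', AllElementary G e₀ R (p - 1) n') {t : ℕ} (ht : t + 2 ≤ p)
    (hlink : G.IsLink (e p) (y t) (y p)) (hψ : R ψ) (h : IsTashkinovSeq G ψ e₀ n y e)
    (hi : i < p) (ha : Missing G ψ a (y i)) (hn : Missing G ψ a (y n)) :
    ∃ ψ' b j, R ψ' ∧ IsTashkinovSeq G ψ' e₀ n y e ∧ j + 2 ≤ p ∧ Missing G ψ' b (y j) ∧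
      Missing G ψ' b (y n) ∧ UnusedUpTo ψ' b p e := by
  -- If `i = p - 1`, an exchange with a colour missing before `y (p - 1)` and unused up to `y p`
  -- reduces to an earlier vertex.
  wlog hip : i + 2 ≤ p generalizing ψ a i
  · obtain rfl : i = p - 1 := by omega
    have hel := H.pred hψ h (r := n - 1) (by omega)
    obtain ⟨b, j, hj, hb, hub⟩ := exists_unused hR hψ h (q := p - 2) (r := p) (by omega)
      (by omega) (hel.mono (by omega)) (by omega)
    have hab : a ≠ b := hel.ne (i := p - 1) (j := j) (by omega) (by omega) (by omega) ha hb
    obtain ⟨ψ', hψ', h', hn', -, hb', -⟩ := H.exchange hR hψ h (r := p - 1) (i := p - 1) (j := j)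
      (by omega) (by omega) le_rfl (by omega) hab ha hb (H.unusedUpTo hψ h (by omega) ha)
      (hub.mono (by omega)) hn
    exact this (i := j) hψ' h' (by omega) hb' hn' (by omega)
  by_cases hua : UnusedUpTo ψ a p e
  · exact ⟨ψ, a, i, hψ, h, hip, ha, hn, hua⟩
  have hel := H.pred hψ h (r := n - 1) (by omega)
  obtain ⟨b, j, hj, hb, hub⟩ := exists_unused hR hψ h (q := p - 2) (r := p) (by omega)
    (by omega) (hel.mono (by omega)) (by omega)
  have hab : a ≠ b := by
    rintro rfl
    exact hua hub
  have : Nonempty β := ⟨e₀⟩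
  have := hR.loopless
  -- If the chain from `y n` meets `y 0, …, y (p - 2)`, it can be attached there. The path tail of
  -- the resulting tree starts at `p - 1`, so the induction hypothesis makes the tree elementary,
  -- although `y n` and `y i` both miss `a`.
  by_cases hD : ∃ l ≤ p - 2, SameComponent G ψ a b (y n) (y l)
  · exfalso
    obtain ⟨l, hl, hs⟩ := hD
    obtain ⟨m, f, g, hf0, hch, hcl⟩ := exists_isClosedChain hR.finite_vertexSet
      (hR.colouring ψ hψ) (Or.inl hn : Missing G ψ a (y n) ∨ Missing G ψ b (y n))
    rw [← hf0] at hs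
    obtain ⟨s, hsm, hsf⟩ := hcl.exists_of_sameComponent hch hs
    have hp1 : p - 1 = p - 2 + 1 := by omega
    rw [hp1] at IH
    refine (h.mono (r := p - 2) (by omega) (by omega)).false_of_chain hψ IH (i := i) (j := j)
      (by omega) hj ha hb hch (hf0 ▸ hn) ?_ ⟨s, hsm, l, hl, hsf.symm⟩
    intro u hu hfu
    rw [hf0] at hfu
    have := h.inj n le_rfl u (by omega) hfu
    omega
  · push Not at hD
    -- Each of `e 2, …, e p` has an end among `y 0, …, y (p - 2)`, which the switched component
    -- avoids; for `e p` this end is `y t`.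
    have hfix : ∀ l, 2 ≤ l → l ≤ p → kempeSwitch G ψ a b (y n) (e l) = ψ (e l) := by
      intro l hl hlp
      rcases hlp.eq_or_lt with rfl | hlp
      · exact kempeSwitch_of_not_mem hlink.inc_left (hD t (by omega))
      · obtain ⟨u, hu, hlu⟩ := h.isLink l (by omega) (by omega)
        exact kempeSwitch_of_not_mem hlu.inc_left (hD u (by omega))
    refine ⟨kempeSwitch G ψ a b (y n), b, j, hR.switch ψ a b _ hψ hab (h.mem_vertexSet le_rfl),
      h.kempeSwitch ha hb (hD i (by omega)) (hD j hj) ?_ ?_, by omega,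
      (missing_kempeSwitch_of_not_mem (hD j hj)).2 hb,
      (missing_kempeSwitch_right sameComponent_self).2 hn, ?_⟩
    · intro l hl hln hc
      rcases le_or_gt l p with h1 | h1
      · rw [hfix l hl h1] at hc
        exact h.lt_of_colour hel (by omega) ha hl hln hc
      · omega
    · intro l hl hln hc
      rcases le_or_gt l p with h1 | h1
      · rw [hfix l hl h1] at hc
        exact (hub l hl h1 hc).elim
      · omega
    · intro l hl hlp hc
      rw [hfix l hl hlp] at hc
      exact hub l hl hlp hc

/-- The case in which the last edge is not attached to the vertex before the last one. -/
lemma InitialElementary.false_of_branch_last (H : InitialElementary G e₀ R n y e)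
    (hR : KempeClass G e₀ R) (hn3 : 3 ≤ n) (IH : AllElementary G e₀ R (n - 1) (n - 1)) {t : ℕ}
    (ht : t + 2 ≤ n) (hlink : G.IsLink (e n) (y t) (y n)) (hψ : R ψ)
    (h : IsTashkinovSeq G ψ e₀ n y e) (hi : i + 2 ≤ n) (ha : Missing G ψ a (y i))
    (hn : Missing G ψ a (y n)) (hua : UnusedUpTo ψ a n e) : False := by
  obtain ⟨c, hc, m, hm, hmc⟩ := h.colour n (by omega) le_rfl
  rcases Nat.lt_or_ge (m + 1) n with hm' | hm'
  · exact h.false_of_skip hψ IH ht hlink hc hm' hmc hi ha hn hn3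
  -- Now the colour of `e n` is missing at `y (n - 1)`, which therefore cannot be dropped yet. A
  -- first exchange gives `e n` the colour `a`, missing at `y i`; a second makes `y n` share the
  -- colour `b` with `y j`, where `j ≤ n - 2`.
  obtain rfl : m = n - 1 := by omega
  have hel := H.pred hψ h (r := n - 1) (by omega)
  have hac : a ≠ c := hel.ne (i := i) (j := n - 1) (by omega) le_rfl (by omega) ha hmc
  obtain ⟨ψ', hψ', h', hn', ha', hc', -, -, hpair⟩ := H.exchange hR hψ h (r := n - 1) (i := i)
    (j := n - 1) (by omega) (by omega) (by omega) le_rfl hac ha hmc (hua.mono (by omega))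
    (H.unusedUpTo hψ h (by omega) hmc) hn
  -- The edge keeps a colour in the pair, and `c` is now missing at its end `y n`.
  have hea : ψ' (e n) = some a :=
    ((hpair (e n)).2 (Or.inr hc)).resolve_right (hn' _ hlink.inc_right)
  have hel' := H.pred hψ' h' (r := n - 1) (by omega)
  obtain ⟨b, j, hj, hb, hub⟩ := exists_unused hR hψ' h' (q := n - 2) (r := n) (by omega)
    (by omega) (hel'.mono (by omega)) (by omega)
  have hcb : c ≠ b := hel'.ne (i := n - 1) (j := j) le_rfl (by omega) (by omega) hc' hb
  have hab : a ≠ b := by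
    rintro rfl
    exact hub n (by omega) le_rfl hea
  obtain ⟨ψ'', hψ'', h'', hn'', -, hb'', hmiss, hcol, -⟩ := H.exchange hR hψ' h' (r := n - 1)
    (i := n - 1) (j := j) (by omega) (by omega) le_rfl (by omega) hcb hc' hb
    (H.unusedUpTo hψ' h' (by omega) hc') (hub.mono (by omega)) hn'
  exact h''.false_of_skip hψ'' IH ht hlink ((hcol a hac hab _).2 hea) hi
    ((hmiss a hac hab _).2 ha') (by omega) hb'' hn'' hn3

/-- Exchanging the first two vertices of a tree. -/
lemma IsTashkinovSeq.swap_first (h : IsTashkinovSeq G ψ e₀ n y e) :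
    IsTashkinovSeq G ψ e₀ n (y ∘ Equiv.swap 0 1) e := by
  have hn := h.one_le
  have hlt : ∀ l, 2 ≤ l → Equiv.swap 0 1 l = l := fun l hl =>
    Equiv.swap_apply_of_ne_of_ne (by omega) (by omega)
  have hle : ∀ l j, 1 ≤ j → l ≤ j → Equiv.swap 0 1 l ≤ j := by
    intro l j hj hlj
    rw [Equiv.swap_apply_def]
    split_ifs <;> omega
  refine ⟨hn, ?_, h.first, ?_, ?_⟩
  · intro u hu v hv huv
    exact (Equiv.swap 0 1).injective (h.inj _ (hle u n hn hu) _ (hle v n hn hv) huv)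
  · intro l hl hln
    rcases hl.eq_or_lt with rfl | hl
    · refine ⟨0, one_pos, ?_⟩
      rw [h.first]
      simpa using h.isLink_first.symm
    · obtain ⟨u, hu, hlu⟩ := h.isLink l (by omega) hln
      refine ⟨Equiv.swap 0 1 u, ?_, ?_⟩
      · have := hle u (l - 1) (by omega) (by omega)
        omega
      · simpa [hlt l hl] using hlu
  · intro l hl hln
    obtain ⟨d, hd, u, hu, hdu⟩ := h.colour l (by omega) hln
    refine ⟨d, hd, Equiv.swap 0 1 u, ?_, ?_⟩
    · have := hle u (l - 1) (by omega) (by omega)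
      omega
    · simpa using hdu

/-- **Tashkinov's theorem**, for a class of partial colourings closed under Kempe changes. -/
theorem KempeClass.allElementary (hR : KempeClass G e₀ R) (p n : ℕ) :
    AllElementary G e₀ R p n := by
  -- Outer induction on the start of the path tail, inner induction on the size of the tree.
  induction p using Nat.strong_induction_on generalizing n with
  | _ p IHp =>
  induction n using Nat.strong_induction_on with
  | _ n IHn =>
  intro ψ hψ y e h htail
  have H : InitialElementary G e₀ R n y e := fun ψ' hψ' r hr h' =>
    IHn r hr ψ' hψ' y e h' fun j hj hpj hjr => htail j hj hpj (hjr.trans hr.le)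
  have key : ∀ i < n, ∀ a, Missing G ψ a (y i) → ¬ Missing G ψ a (y n) := by
    intro i hi a ha hn
    rcases le_or_gt p i with hpi | hip
    · exact H.false_of_missing_tail hR htail hpi hi ψ a hψ h ha hn
    have hn1 := h.one_le
    -- For `n < p` the tail condition is vacuous, so `p` can be lowered to `n`.
    rcases le_or_gt p n with hpn | hpn
    swap
    · have := IHp n hpn n ψ hψ y e h (fun j _ h1 h2 => by omega) i hi.le n le_rfl a ha hn
      omega
    obtain ⟨t, ht, hlink⟩ := h.isLink p (by omega) hpn
    -- If `e p` is attached to `y (p - 1)`, the path tail already starts one vertex earlier.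
    rcases Nat.lt_or_ge (t + 1) p with ht' | ht'
    swap
    · have htail' : HasPathTail G (p - 1) n y e := by
        intro j hj hpj hjn
        rcases Nat.lt_or_ge p j with h1 | h1
        · exact htail j hj h1 hjn
        · obtain rfl : j = p := by omega
          obtain rfl : t = j - 1 := by omega
          exact hlink
      have := IHp (p - 1) (by omega) n ψ hψ y e h htail' i hi.le n le_rfl a ha hn
      omega
    rcases Nat.lt_or_ge 2 p with hp3 | hp2
    · obtain ⟨ψ', b, j, hψ', h', hj, hb, hbn, hub⟩ := H.exists_unused_common hR hp3 hpn
        (fun n' => IHp (p - 1) (by omega) n') ht' hlink hψ h hip ha hn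
      rcases hpn.eq_or_lt with rfl | hpn
      · exact H.false_of_branch_last hR hp3 (IHp (p - 1) (by omega) _) ht' hlink hψ' h' hj hb
          hbn hub
      · exact H.false_of_unused hR hψ' h' htail (by omega) hpn hb hbn hub
    -- Here `e 2` is attached to `y 0`. The ends of `e₀` play symmetric roles, and interchanging
    -- them makes the tail start at position `1`.
    · obtain rfl : p = 2 := by omega
      obtain rfl : t = 0 := by omega
      have htail' : HasPathTail G 1 n (y ∘ Equiv.swap 0 1) e := by
        intro j hj hpj hjn
        have hj' : Equiv.swap 0 1 j = j := Equiv.swap_apply_of_ne_of_ne (by omega) (by omega)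
        rw [Function.comp_apply, Function.comp_apply, hj']
        rcases Nat.lt_or_ge 2 j with h1 | h1
        · rw [Equiv.swap_apply_of_ne_of_ne (by omega) (by omega)]
          exact htail j hj h1 hjn
        · obtain rfl : j = 2 := by omega
          simpa using hlink
      have hn' : Equiv.swap 0 1 n = n := Equiv.swap_apply_of_ne_of_ne (by omega) (by omega)
      have hin : Equiv.swap 0 1 i ≤ n := by
        rw [Equiv.swap_apply_def]
        split_ifs <;> omega
      have := IHp 1 (by omega) n ψ hψ _ e h.swap_first htail' (Equiv.swap 0 1 i) hin n le_rfl a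
        (by simpa using ha) (by simpa [hn'] using hn)
      rw [← hn', (Equiv.swap 0 1).injective.eq_iff] at this
      omega
  intro i hi j hj a ha hja
  by_contra hij
  rcases hi.eq_or_lt with rfl | hi
  · exact key j (by omega) a hja ha
  rcases hj.eq_or_lt with rfl | hj
  · exact key i hi a ha hja
  exact hij (H.pred hψ h (r := n - 1) (by omega) i (by omega) j (by omega) a ha hja)

end Tashkinov

end EdgeColouring

namespace EdgeColouring

/-! ### Tashkinov trees as sets, and maximal trees -/

section Trees

variable {α β : Type*} {k : ℕ} {G : Graph α β} {φ ψ : β → Option (Fin k)} {e₀ e : β}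
  {a b c : Fin k} {S : Set α} {F : Set β} {x : α} {R : (β → Option (Fin k)) → Prop}

lemma W_subset_vertexSet : W G φ e₀ ⊆ G.vertexSet := by
  intro x hx
  induction hx with
  | start x hx => exact hx.vertex_mem
  | grow u v w e c _ he _ _ _ _ _ => exact he.right_mem

lemma mem_W_of_missing {u v : α} (hu : u ∈ W G φ e₀) (he : G.IsLink e u v) (hc : φ e = some c)
    (hmc : c ∈ missingColours G φ (W G φ e₀)) : v ∈ W G φ e₀ := by
  obtain ⟨w, hw, hcw⟩ := hmc
  exact MemW.grow u v w e c hu he hc hw hcw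

namespace IsTashkinovTree

lemma subset_W (h : IsTashkinovTree G φ e₀ S F) : S ⊆ W G φ e₀ := by
  induction h with
  | start x y h =>
    rintro z (rfl | rfl)
    · exact MemW.start _ h.inc_left
    · exact MemW.start _ h.inc_right
  | grow S F u v w e c _ hu hv he hc hw hcw ih =>
    rintro z (rfl | hz)
    · exact MemW.grow u _ w e c (ih hu) he hc (ih hw) hcw
    · exact ih hz

lemma inc_mem (h : IsTashkinovTree G φ e₀ S F) (hx : G.Inc e₀ x) : x ∈ S := by
  induction h with
  | start y z h => exact hx.eq_or_eq_of_isLink h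
  | grow S F u v w e c _ hu hv he hc hw hcw ih => exact Or.inr ih

lemma edge_ends (h : IsTashkinovTree G φ e₀ S F) (he : e ∈ F) (hx : G.Inc e x) : x ∈ S := by
  induction h with
  | start y z h =>
    rw [Set.mem_singleton_iff] at he
    subst he
    exact hx.eq_or_eq_of_isLink h
  | grow S F u v w f c _ hu hv hf hc hw hcw ih =>
    rcases he with rfl | he
    · rcases hx.eq_or_eq_of_isLink hf with rfl | rfl
      · exact Or.inr hu
      · exact Or.inl rfl
    · exact Or.inr (ih he)

lemma edge_subset (h : IsTashkinovTree G φ e₀ S F) : F ⊆ G.edgeSet := by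
  induction h with
  | start y z h => simpa using h.edge_mem
  | grow S F u v w f c _ hu hv hf hc hw hcw ih => exact Set.insert_subset hf.edge_mem ih

lemma exists_inc (h : IsTashkinovTree G φ e₀ S F) (he : e ∈ F) : ∃ x, G.Inc e x := by
  obtain ⟨x, y, hxy⟩ := G.exists_isLink_of_mem_edgeSet (h.edge_subset he)
  exact ⟨x, hxy.inc_left⟩

lemma missing_of_mem (h : IsTashkinovTree G φ e₀ S F) (hφ : φ e₀ = none) (he : e ∈ F)
    (hc : φ e = some c) : c ∈ missingColours G φ S := by
  induction h with
  | start y z h =>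
    rw [Set.mem_singleton_iff] at he
    rw [he, hφ] at hc
    cases hc
  | grow S F u v w f d _ hu hv hf hd hw hdw ih =>
    rcases he with rfl | he
    · rw [hc, Option.some.injEq] at hd
      subst hd
      exact ⟨w, Or.inr hw, hdw⟩
    · obtain ⟨z, hz, hcz⟩ := ih he
      exact ⟨z, Or.inr hz, hcz⟩

lemma mem_missingColours_of_mem_usedColours (h : IsTashkinovTree G φ e₀ S F) (hφ : φ e₀ = none)
    (hc : c ∈ usedColours φ F) : c ∈ missingColours G φ S := by
  obtain ⟨e, he, hec⟩ := hc
  exact h.missing_of_mem hφ he hec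

lemma congr (h : IsTashkinovTree G φ e₀ S F)
    (hF : ∀ e ∈ F, ∀ c, φ e = some c → ψ e = some c)
    (hS : ∀ e ∈ F, ∀ c, φ e = some c → ∀ x ∈ S, Missing G φ c x → Missing G ψ c x) :
    IsTashkinovTree G ψ e₀ S F := by
  induction h with
  | start y z h => exact .start y z h
  | grow S F u v w f d _ hu hv hf hd hw hdw ih =>
    refine .grow S F u v w f d (ih (fun e he => hF e (Or.inr he)) ?_) hu hv hf
      (hF f (Or.inl rfl) d hd) hw (hS f (Or.inl rfl) d hd w (Or.inr hw) hdw)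
    exact fun e he c hc x hx => hS e (Or.inr he) c hc x (Or.inr hx)

lemma kempeSwitch_of_disjoint (h : IsTashkinovTree G φ e₀ S F)
    (hx : ∀ w ∈ S, ¬ SameComponent G φ a b x w) :
    IsTashkinovTree G (kempeSwitch G φ a b x) e₀ S F := by
  refine h.congr (fun e he c hc => ?_) fun e he c hc w hw hcw =>
    (missing_kempeSwitch_of_not_mem (hx w hw)).2 hcw
  obtain ⟨y, hy⟩ := h.exists_inc he
  rwa [kempeSwitch_of_not_mem hy (hx y (h.edge_ends he hy))]

lemma kempeSwitch_of_unused (h : IsTashkinovTree G φ e₀ S F) (ha : a ∉ usedColours φ F)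
    (hb : b ∉ usedColours φ F) : IsTashkinovTree G (kempeSwitch G φ a b x) e₀ S F := by
  have key : ∀ e ∈ F, ∀ c, φ e = some c → c ≠ a ∧ c ≠ b := by
    intro e he c hc
    exact ⟨fun h => ha (h ▸ ⟨e, he, hc⟩), fun h => hb (h ▸ ⟨e, he, hc⟩)⟩
  exact h.congr
    (fun e he c hc => (kempeSwitch_eq_some_iff_of_ne (key e he c hc).1 (key e he c hc).2).2 hc)
    fun e he c hc w _ hcw =>
      (missing_kempeSwitch_of_ne (key e he c hc).1 (key e he c hc).2).2 hcw

lemma exists_seq [G.Loopless] (h : IsTashkinovTree G φ e₀ S F) :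
    ∃ n y e, IsTashkinovSeq G φ e₀ n y e ∧ S = {x | ∃ i ≤ n, x = y i} := by
  induction h with
  | start u v h =>
    refine ⟨1, fun i => if i = 0 then u else v, fun _ => e₀, ⟨le_rfl, ?_, rfl, ?_, ?_⟩, ?_⟩
    · intro i hi j hj hij
      have := h.ne
      have := h.ne.symm
      interval_cases i <;> interval_cases j <;> simp_all
    · intro j hj hj1
      obtain rfl : j = 1 := by omega
      exact ⟨0, one_pos, by simpa using h⟩
    · intro j hj hj1
      omega
    · ext x
      constructor
      · rintro (rfl | rfl)
        · exact ⟨0, by omega, by simp⟩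
        · exact ⟨1, by omega, by simp⟩
      · rintro ⟨i, hi, rfl⟩
        interval_cases i <;> simp
  | grow S F u v w f d _ hu hv hf hd hw hdw ih =>
    obtain ⟨n, y, e, hseq, rfl⟩ := ih
    obtain ⟨i, hi, rfl⟩ := hu
    obtain ⟨l, hl, rfl⟩ := hw
    obtain ⟨y', hy, hy'⟩ : ∃ y' : ℕ → α, (∀ j ≤ n, y' j = y j) ∧ y' (n + 1) = v :=
      ⟨fun j => if j ≤ n then y j else v, fun j hj => if_pos hj, if_neg (by omega)⟩
    obtain ⟨e', he, he'⟩ : ∃ e' : ℕ → β, (∀ j ≤ n, e' j = e j) ∧ e' (n + 1) = f :=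
      ⟨fun j => if j ≤ n then e j else f, fun j hj => if_pos hj, if_neg (by omega)⟩
    have hle : ∀ j, j ≤ n + 1 → j ≤ n ∨ j = n + 1 := fun j hj => by omega
    refine ⟨n + 1, y', e', ⟨by omega, ?_, (he 1 hseq.one_le).trans hseq.first, ?_, ?_⟩, ?_⟩
    · intro p hp q hq hpq
      have hv' : ∀ j ≤ n, y j ≠ v := fun j hj hjv => hv ⟨j, hj, hjv.symm⟩
      rcases hle _ hp with hp | rfl <;> rcases hle _ hq with hq | rfl
      · rw [hy p hp, hy q hq] at hpq
        exact hseq.inj p hp q hq hpq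
      · rw [hy p hp, hy'] at hpq
        exact (hv' p hp hpq).elim
      · rw [hy q hq, hy'] at hpq
        exact (hv' q hq hpq.symm).elim
      · rfl
    · intro j hj hjn
      rcases hle _ hjn with hjn | rfl
      · obtain ⟨t, ht, hlink⟩ := hseq.isLink j hj hjn
        refine ⟨t, ht, ?_⟩
        rwa [he j hjn, hy j hjn, hy t (by omega)]
      · refine ⟨i, by omega, ?_⟩
        rwa [he', hy', hy i hi]
    · intro j hj hjn
      rcases hle _ hjn with hjn | rfl
      · obtain ⟨c, hc, t, ht, htc⟩ := hseq.colour j hj hjn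
        refine ⟨c, by rwa [he j hjn], t, ht, ?_⟩
        rwa [hy t (by omega)]
      · refine ⟨d, by rwa [he'], l, by omega, ?_⟩
        rwa [hy l hl]
    · ext x
      constructor
      · rintro (rfl | ⟨j, hj, rfl⟩)
        · exact ⟨n + 1, le_rfl, hy'.symm⟩
        · exact ⟨j, by omega, (hy j hj).symm⟩
      · rintro ⟨j, hj, rfl⟩
        rcases hle _ hj with hj | rfl
        · exact Or.inr ⟨j, hj, hy j hj⟩
        · exact Or.inl hy'

lemma subset_vertexSet (h : IsTashkinovTree G φ e₀ S F) : S ⊆ G.vertexSet :=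
  h.subset_W.trans W_subset_vertexSet

lemma ncard_edges_lt [G.Loopless] (hV : G.vertexSet.Finite) (h : IsTashkinovTree G φ e₀ S F) :
    F.ncard + 1 ≤ S.ncard := by
  induction h with
  | start u v h => rw [Set.ncard_singleton, Set.ncard_pair h.ne]
  | grow S F u v w f d hS hu hv hf hd hw hdw ih =>
    rw [Set.ncard_insert_of_notMem hv (hV.subset hS.subset_vertexSet)]
    have := Set.ncard_insert_le f F
    omega

lemma start_mem (h : IsTashkinovTree G φ e₀ S F) : e₀ ∈ F := by
  induction h with
  | start u v h => rfl
  | grow S F u v w f d hS hu hv hf hd hw hdw ih => exact Or.inr ih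

end IsTashkinovTree

/-- By induction along the generation of `W`: a first generated vertex outside the tree could be
added to it. -/
lemma IsMaximalTashkinovTree.fst_eq_W {T : Set α × Set β} (h : IsMaximalTashkinovTree G φ e₀ T) :
    T.1 = W G φ e₀ := by
  refine h.prop.subset_W.antisymm fun x hx => ?_
  induction hx with
  | start x hx => exact h.prop.inc_mem hx
  | grow u v w e c _ he hc _ hcw hu hw =>
    by_contra hv
    have h1 := IsTashkinovTree.grow T.1 T.2 u v w e c h.prop hu hv he hc hw hcw
    exact hv ((h.le_of_ge (y := (insert v T.1, insert e T.2)) h1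
      ⟨Set.subset_insert _ _, Set.subset_insert _ _⟩).1 (Set.mem_insert _ _))

lemma exists_isMaximalTashkinovTree (hV : G.vertexSet.Finite) (hE : G.edgeSet.Finite)
    (he₀ : e₀ ∈ G.edgeSet) : ∃ T, IsMaximalTashkinovTree G φ e₀ T := by
  obtain ⟨x, y, hxy⟩ := G.exists_isLink_of_mem_edgeSet he₀
  have hfin : {T : Set α × Set β | IsTashkinovTree G φ e₀ T.1 T.2}.Finite := by
    refine (hV.finite_subsets.prod hE.finite_subsets).subset fun T hT => ?_
    have hT' : IsTashkinovTree G φ e₀ T.1 T.2 := hT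
    exact ⟨hT'.subset_vertexSet, hT'.edge_subset⟩
  exact hfin.exists_maximal ⟨({x, y}, {e₀}), IsTashkinovTree.start x y hxy⟩

namespace KempeClass

/-- Numbering the tree and taking `p = n` makes the tail condition vacuous, so Tashkinov's theorem
covers every tree. -/
lemma isElementary_of_tree (hR : KempeClass G e₀ R) (hψ : R ψ) (h : IsTashkinovTree G ψ e₀ S F) :
    IsElementary G ψ S := by
  have := hR.loopless
  obtain ⟨n, y, e, hseq, rfl⟩ := h.exists_seq
  rintro x ⟨i, hi, rfl⟩ z ⟨j, hj, rfl⟩ hxz c ⟨hcx, hcz⟩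
  refine hxz ?_
  rw [hR.allElementary n n ψ hψ y e hseq (fun l _ h1 h2 => by omega) i hi j hj c hcx hcz]

/-- At least `|S| + 2` colours are missing in `S`, and the at most `|S| - 1` tree edges together
with `b` exclude at most `|S|` of them. -/
lemma exists_missing_unused (hR : KempeClass G e₀ R) (hψ : R ψ)
    (h : IsTashkinovTree G ψ e₀ S F) (b : Fin k) :
    ∃ c ∈ missingColours G ψ S, c ∉ usedColours ψ F ∧ c ≠ b := by
  classical
  have := hR.loopless
  have hSfin : S.Finite := hR.finite_vertexSet.subset h.subset_vertexSet
  have hFfin : F.Finite := hR.finite_edgeSet.subset h.edge_subset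
  have hE := h.edge_subset h.start_mem
  obtain ⟨x, y, hxy⟩ := G.exists_isLink_of_mem_edgeSet hE
  have hcard := h.ncard_edges_lt hR.finite_vertexSet
  let U : Finset (Fin k) := insert b (Finset.univ.filter fun c => c ∈ usedColours ψ F)
  have hU : U.card ≤ F.ncard + 1 := by
    refine (Finset.card_insert_le _ _).trans (Nat.succ_le_succ ?_)
    have hsub : (Finset.univ.filter fun c => c ∈ usedColours ψ F).image some ⊆
        hFfin.toFinset.image ψ := by
      intro o ho
      obtain ⟨c, hc, rfl⟩ := Finset.mem_image.1 ho
      obtain ⟨e, he, hec⟩ := (Finset.mem_filter.1 hc).2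
      exact Finset.mem_image.2 ⟨e, hFfin.mem_toFinset.2 he, hec⟩
    have := (Finset.card_le_card hsub).trans Finset.card_image_le
    rwa [Finset.card_image_of_injective _ (Option.some_injective _),
      ← Set.ncard_eq_toFinset_card _ hFfin] at this
  rw [Set.ncard_eq_toFinset_card _ hSfin] at hcard
  obtain ⟨c, hcU, z, hz, hcz⟩ := exists_missing_not_mem hR.finite_edgeSet hR.degree_lt
    (S := hSfin.toFinset) (φ := ψ) (U := U) (e₀ := e₀)
    (fun z hz => h.subset_vertexSet (hSfin.mem_toFinset.1 hz))
    (by rw [hSfin.coe_toFinset]; exact hR.isElementary_of_tree hψ h) (hR.uncoloured ψ hψ) hxy.ne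
    (hSfin.mem_toFinset.2 (h.inc_mem hxy.inc_left))
    (hSfin.mem_toFinset.2 (h.inc_mem hxy.inc_right)) hxy.inc_left hxy.inc_right (by omega)
  refine ⟨c, ⟨z, hSfin.mem_toFinset.1 hz, hcz⟩, fun hc => hcU ?_, fun hc => hcU ?_⟩
  · exact Finset.mem_insert_of_mem (Finset.mem_filter.2 ⟨Finset.mem_univ _, hc⟩)
  · exact hc ▸ Finset.mem_insert_self _ _

/-- The set `S` stays fixed while the colouring varies: a tree surviving a recolouring gives one
inclusion, and the bound on all `W` forces equality. -/
lemma W_eq_of_tree (hR : KempeClass G e₀ R) (hψ : R ψ) (h : IsTashkinovTree G ψ e₀ S F)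
    (hmax : ∀ ψ, R ψ → (W G ψ e₀).ncard ≤ S.ncard) : W G ψ e₀ = S :=
  (Set.eq_of_subset_of_ncard_le h.subset_W (hmax ψ hψ)
    (hR.finite_vertexSet.subset W_subset_vertexSet)).symm

/-- Edges of missing colours do not leave the vertex set of a maximal tree. -/
lemma mem_of_missing (hR : KempeClass G e₀ R) (hψ : R ψ) (h : IsTashkinovTree G ψ e₀ S F)
    (hmax : ∀ ψ, R ψ → (W G ψ e₀).ncard ≤ S.ncard) {u v : α} (hu : u ∈ S)
    (he : G.IsLink e u v) (hc : ψ e = some c) (hmc : c ∈ missingColours G ψ S) : v ∈ S := by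
  rw [← hR.W_eq_of_tree hψ h hmax] at hu hmc ⊢
  exact mem_W_of_missing hu he hc hmc

/-- If `b` is missing at the vertex `v` of a maximal tree and unused on the tree, then every edge
leaving the tree, of a colour `a` not missing in the tree, is in the `(a, b)`-component of `v`. -/
lemma sameComponent_of_boundary (hR : KempeClass G e₀ R) (hψ : R ψ)
    (h : IsTashkinovTree G ψ e₀ S F) (hmax : ∀ ψ, R ψ → (W G ψ e₀).ncard ≤ S.ncard) {v x z : α}
    (hv : v ∈ S) (hb : Missing G ψ b v) (hbF : b ∉ usedColours ψ F)
    (ha : a ∉ missingColours G ψ S) (he : G.IsLink e x z) (hx : x ∈ S) (hz : z ∉ S)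
    (hea : ψ e = some a) : SameComponent G ψ a b v x := by
  by_contra hns
  have hns' : ¬ SameComponent G ψ a b x v := fun hs => hns hs.symm
  have hab : a ≠ b := by
    rintro rfl
    exact ha ⟨v, hv, hb⟩
  have hψ' := hR.switch ψ a b x hψ hab he.left_mem
  -- Tree edges carry only missing colours, so the tree uses neither `a` nor `b` and survives the
  -- switch. Afterwards `e` has colour `b`, still missing at `v`, yet leaves `S`.
  have haF : a ∉ usedColours ψ F := fun h' =>
    ha (h.mem_missingColours_of_mem_usedColours (hR.uncoloured ψ hψ) h')
  have h' := h.kempeSwitch_of_unused (x := x) haF hbF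
  refine hz (hR.mem_of_missing hψ' h' hmax hx he (c := b) ?_
    ⟨v, hv, (missing_kempeSwitch_of_not_mem hns').2 hb⟩)
  rw [kempeSwitch_of_mem he.inc_left sameComponent_self, hea, Option.map_some,
    Equiv.swap_apply_left]

end KempeClass

end Trees

end EdgeColouring

namespace EdgeColouring

/-! ### The outer segment of the alternating path -/

section Exit

variable {α β : Type*} {k : ℕ}

/-- An alternating chain in the colours `a` and `b` that starts at a vertex of `S` missing `b`,
leaves `S` at its vertex number `s` and stays outside `S` before the vertex number `t`. -/
structure IsExitChain (G : Graph α β) (S : Set α) (F : Set β) (a b : Fin k) (m : ℕ) (f : ℕ → α)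
    (g : ℕ → β) (s t : ℕ) (φ : β → Option (Fin k)) : Prop where
  chain : IsChain G φ a b m f g
  pos : 0 < s
  lt : s < t
  le : t ≤ m
  mem : ∀ i < s, f i ∈ S
  not_mem : ∀ i, s ≤ i → i < t → f i ∉ S
  missing : Missing G φ b (f 0)
  not_missing : a ∉ missingColours G φ S
  unused : b ∉ usedColours φ F
  boundary : ∃ e₁ ∈ boundaryEdges G φ S a, ∃ e₂ ∈ boundaryEdges G φ S a, e₁ ≠ e₂

/-- The vertices of `S` and those of the chain outside `S` and before the vertex number `j`. -/
def exitSet (S : Set α) (f : ℕ → α) (s j : ℕ) : Set α := S ∪ {x | ∃ i, s ≤ i ∧ i < j ∧ x = f i}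

variable {G : Graph α β} {φ ψ : β → Option (Fin k)} {e₀ : β} {R : (β → Option (Fin k)) → Prop}
  {S : Set α} {F : Set β} {a b c d : Fin k} {m : ℕ} {f : ℕ → α} {g : ℕ → β} {s t i j : ℕ} {x : α}

/-- Components in two missing colours do not leave a maximal tree. -/
lemma KempeClass.not_sameComponent_of_missing (hR : KempeClass G e₀ R)
    (hψ : R ψ) (hT : IsTashkinovTree G ψ e₀ S F)
    (hmax : ∀ ψ, R ψ → (W G ψ e₀).ncard ≤ S.ncard) (hc : c ∈ missingColours G ψ S)
    (hd : d ∈ missingColours G ψ S) (hx : x ∉ S) : ∀ w ∈ S, ¬ SameComponent G ψ c d x w := by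
  intro w hw hs
  obtain ⟨e, u, v, he, hec, hu, hv, -⟩ := hs.exists_boundary hx hw
  rcases hec with hec | hec
  · exact hv (hR.mem_of_missing hψ hT hmax hu he hec hc)
  · exact hv (hR.mem_of_missing hψ hT hmax hu he hec hd)

namespace IsExitChain

lemma switch (h : IsExitChain G S F a b m f g s t φ) (hca : c ≠ a) (hcb : c ≠ b)
    (hda : d ≠ a) (hdb : d ≠ b) :
    IsExitChain G S F a b m f g s t (kempeSwitch G φ c d x) := by
  have ha : ∀ e, kempeSwitch G φ c d x e = some a ↔ φ e = some a := fun e =>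
    kempeSwitch_eq_some_iff_of_ne hca.symm hda.symm
  have hb : ∀ e, kempeSwitch G φ c d x e = some b ↔ φ e = some b := fun e =>
    kempeSwitch_eq_some_iff_of_ne hcb.symm hdb.symm
  have hB : boundaryEdges G (EdgeColouring.kempeSwitch G φ c d x) S a = boundaryEdges G φ S a := by
    ext e
    exact and_congr_left' (ha e)
  refine ⟨⟨h.chain.inj, h.chain.isLink, fun i hi => ?_⟩, h.pos, h.lt, h.le, h.mem, h.not_mem,
    (missing_kempeSwitch_of_ne hcb.symm hdb.symm).2 h.missing, ?_, ?_, hB ▸ h.boundary⟩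
  · rw [ha, hb]
    exact h.chain.colour i hi
  · rintro ⟨x, hx, hxa⟩
    exact h.not_missing ⟨x, hx, (missing_kempeSwitch_of_ne hca.symm hda.symm).1 hxa⟩
  · rintro ⟨e, he, heb⟩
    exact h.unused ⟨e, he, (hb e).1 heb⟩

lemma interior (h : IsExitChain G S F a b m f g s t φ) (hφ : IsPartialColouring G φ)
    (hj : s ≤ j) (hjt : j < t) : ¬ Missing G φ a (f j) ∧ ¬ Missing G φ b (f j) :=
  h.chain.not_missing_of_interior hφ (h.pos.trans_le hj) (hjt.trans_le h.le)

lemma mem_exitSet (hi : s ≤ i) (hij : i < j) : f i ∈ exitSet S f s j := Or.inr ⟨i, hi, hij, rfl⟩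

lemma ne (h : IsExitChain G S F a b m f g s t φ) (hi : i < t) (hj : j < t) (hij : i ≠ j) :
    f i ≠ f j := by
  have := h.le
  exact fun hf => hij (h.chain.inj i (by omega) j (by omega) hf)

lemma not_mem_missingColours (h : IsExitChain G S F a b m f g s t φ)
    (hel : IsElementary G φ (exitSet S f s j)) (hi : s ≤ i) (hij : i < j) (hjt : j ≤ t)
    (hc : Missing G φ c (f i)) : c ∉ missingColours G φ S := by
  rintro ⟨x, hx, hcx⟩
  refine hel x (Or.inl hx) (f i) (mem_exitSet hi hij) ?_ c ⟨hcx, hc⟩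
  rintro rfl
  exact h.not_mem i hi (by omega) hx

/-- No Kempe change outside `S` can shorten the chain so that it ends before returning to `S`. -/
lemma false_of_short (h : IsExitChain G S F a b m f g s t φ) (hR : KempeClass G e₀ R) (hφ : R φ)
    (hT : IsTashkinovTree G φ e₀ S F) (hmax : ∀ ψ, R ψ → (W G ψ e₀).ncard ≤ S.ncard)
    (hcd : c ≠ d) (hx : x ∈ G.vertexSet) (hxS : ∀ w ∈ S, ¬ SameComponent G φ c d x w)
    (hj : s ≤ j) (hjt : j < t)
    (hg : ∀ i < j, EdgeColouring.kempeSwitch G φ c d x (g i) = φ (g i))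
    (hend : Missing G (EdgeColouring.kempeSwitch G φ c d x) a (f j) ∨
      Missing G (EdgeColouring.kempeSwitch G φ c d x) b (f j)) : False := by
  set ψ := EdgeColouring.kempeSwitch G φ c d x with hψdef
  have hψ : R ψ := hR.switch φ c d x hφ hcd hx
  have hT' : IsTashkinovTree G ψ e₀ S F := hT.kempeSwitch_of_disjoint hxS
  have hinc : ∀ e w, w ∈ S → G.Inc e w → ψ e = φ e := fun e w hw he =>
    kempeSwitch_of_not_mem he (hxS w hw)
  have hmiss : ∀ w ∈ S, ∀ c, Missing G ψ c w ↔ Missing G φ c w := fun w hw c =>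
    missing_kempeSwitch_of_not_mem (hxS w hw)
  have h0 : f 0 ∈ S := h.mem 0 h.pos
  have hb : Missing G ψ b (f 0) := (hmiss _ h0 b).2 h.missing
  have ha : a ∉ missingColours G ψ S := by
    rintro ⟨w, hw, hwa⟩
    exact h.not_missing ⟨w, hw, (hmiss w hw a).1 hwa⟩
  have hbF : b ∉ usedColours ψ F := by
    rintro ⟨e, he, heb⟩
    obtain ⟨w, hw⟩ := hT.exists_inc he
    rw [hinc e w (hT.edge_ends he hw) hw] at heb
    exact h.unused ⟨e, he, heb⟩
  have hle := h.le
  have hpos := h.pos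
  have hch : IsChain G ψ a b j f g :=
    ⟨(h.chain.mono (by omega)).inj, (h.chain.mono (by omega)).isLink, fun i hi => by
      rw [hg i hi]
      exact h.chain.colour i (by omega)⟩
  -- Both ends of the truncated chain now miss `a` or `b`, so it is a whole component. It must
  -- contain all boundary edges of colour `a`, but it crosses the boundary only at `g (s - 1)`.
  have hcl := hch.isClosedChain (hR.colouring ψ hψ) (by omega) (Or.inr hb) hend
  have key : ∀ e ∈ boundaryEdges G φ S a, e = g (s - 1) := by
    rintro e ⟨hea, u, hu, v, hv, huv⟩
    have hea' : ψ e = some a := (hinc e u hu huv.inc_left).trans hea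
    have hs := hR.sameComponent_of_boundary hψ hT' hmax h0 hb hbF ha huv hu hv hea'
    obtain ⟨i, hi, rfl⟩ := hcl.exists_of_sameComponent hch hs
    obtain ⟨l, hl, rfl⟩ := hcl i hi e huv.inc_left (Or.inl hea')
    have h1 := h.chain.isLink l (by omega)
    congr 1
    rcases Nat.lt_or_ge (l + 1) s with h2 | h2
    · exfalso
      rcases huv.inc_right.eq_or_eq_of_isLink h1 with rfl | rfl
      · exact hv (h.mem l (by omega))
      · exact hv (h.mem _ h2)
    · by_contra h3
      rcases huv.inc_left.eq_or_eq_of_isLink h1 with h4 | h4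
      · rw [h4] at hu
        exact h.not_mem l (by omega) (by omega) hu
      · rw [h4] at hu
        exact h.not_mem (l + 1) (by omega) (by omega) hu
  obtain ⟨e₁, he₁, e₂, he₂, hne⟩ := h.boundary
  exact hne ((key e₁ he₁).trans (key e₂ he₂).symm)

/-- Two vertices of the outer segment of the chain have no common missing colour. -/
lemma false_of_missing_outside (hR : KempeClass G e₀ R)
    (hmax : ∀ ψ, R ψ → (W G ψ e₀).ncard ≤ S.ncard)
    (IH : ∀ ψ, R ψ → IsTashkinovTree G ψ e₀ S F → IsExitChain G S F a b m f g s t ψ →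
      IsElementary G ψ (exitSet S f s j)) (hjt : j < t) (hi : s ≤ i) (hij : i < j) :
    ∀ ψ c, R ψ → IsTashkinovTree G ψ e₀ S F → IsExitChain G S F a b m f g s t ψ →
      Missing G ψ c (f i) → Missing G ψ c (f j) → False := by
  obtain ⟨n, hn⟩ : ∃ n, j = i + 1 + n := ⟨j - i - 1, by omega⟩
  induction n generalizing i with
  | zero =>
    intro ψ c hψ hT h hci hcj
    obtain rfl : j = i + 1 := by omega
    have hle := h.le
    have hlink := h.chain.isLink i (by omega)
    have hnb := h.interior (hR.colouring ψ hψ) hi (by omega)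
    obtain ⟨d, hd, hdab⟩ : ∃ d, ψ (g i) = some d ∧ (d = a ∨ d = b) := by
      rcases h.chain.colour i (by omega) with h1 | h1
      · exact ⟨a, h1, Or.inl rfl⟩
      · exact ⟨b, h1, Or.inr rfl⟩
    have hdc : d ≠ c := by
      rintro rfl
      exact hci _ hlink.inc_left hd
    -- The edge `g i` alone is a `(d, c)`-component. Switching it frees its colour `d`, one of `a`
    -- and `b`, at `f i`, where the chain then ends.
    have hcomp : ∀ z, SameComponent G ψ d c (f (i + 1)) z → z = f (i + 1) ∨ z = f i := fun z hz =>
      eq_or_eq_of_sameComponent_edge (hR.colouring ψ hψ) hlink.symm hd hcj hci hz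
    refine h.false_of_short hR hψ hT hmax hdc hlink.right_mem ?_ hi (by omega) ?_ ?_
    · intro w hw hs
      rcases hcomp w hs with rfl | rfl
      · exact h.not_mem _ (by omega) (by omega) hw
      · exact h.not_mem _ (by omega) (by omega) hw
    · intro l hl
      refine kempeSwitch_of_not_mem (h.chain.isLink l (by omega)).inc_left fun hs => ?_
      rcases hcomp _ hs with h1 | h1
      · exact h.ne (by omega) (by omega) (by omega) h1
      · exact h.ne (by omega) (by omega) (by omega) h1
    · have hs := sameComponent_of_isLink hlink.symm (Or.inl hd : ψ (g i) = some d ∨ _ = some c)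
      have := (missing_kempeSwitch_left hs).2 hci
      rcases hdab with rfl | rfl
      · exact Or.inl this
      · exact Or.inr this
  | succ n ih =>
    intro ψ c hψ hT h hci hcj
    have hle := h.le
    have hφ := hR.colouring ψ hψ
    have hlink := h.chain.isLink i (by omega)
    obtain ⟨d, hd⟩ := hR.exists_missing (φ := ψ) hlink.right_mem
    have hel := IH ψ hψ hT h
    have hint := h.interior hφ hi (by omega)
    have hint' := h.interior hφ (j := i + 1) (by omega) (by omega)
    have hcd : c ≠ d := by
      rintro rfl
      exact hel _ (mem_exitSet hi hij) _ (mem_exitSet (i := i + 1) (by omega) (by omega))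
        (h.ne (by omega) (by omega) (by omega)) c ⟨hci, hd⟩
    have hcS := h.not_mem_missingColours hel hi hij hjt.le hci
    have hdS := h.not_mem_missingColours hel (i := i + 1) (by omega) (by omega) hjt.le hd
    have hF : ∀ c, c ∉ missingColours G ψ S → c ∉ usedColours ψ F := fun c hc hc' =>
      hc (hT.mem_missingColours_of_mem_usedColours (hR.uncoloured ψ hψ) hc')
    have hψ' := hR.switch ψ c d (f (i + 1)) hψ hcd hlink.right_mem
    have hT' := hT.kempeSwitch_of_unused (x := f (i + 1)) (hF c hcS) (hF d hdS)
    have h' : IsExitChain G S F a b m f g s t (EdgeColouring.kempeSwitch G ψ c d (f (i + 1))) := by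
      refine h.switch ?_ ?_ ?_ ?_ <;> rintro rfl
      exacts [hint.1 hci, hint.2 hci, hint'.1 hd, hint'.2 hd]
    have hc' := (missing_kempeSwitch_left (sameComponent_self (G := G) (φ := ψ) (a := c) (b := d)
      (x := f (i + 1)))).2 hd
    -- After the switch `f (i + 1)` misses `c`. If `f i` is in its component, then `f j` would be a
    -- third such vertex, so it is unaffected and the pair `i + 1, j` is closer. Otherwise `f i` and
    -- `f (i + 1)` both miss `c`, against the elementarity known before `f j`.
    by_cases hs : SameComponent G ψ c d (f (i + 1)) (f i)
    · have hns : ¬ SameComponent G ψ c d (f (i + 1)) (f j) := by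
        intro hs'
        rcases hR.eq_or_eq_or_eq hψ (Or.inr hd) (Or.inl hci) (Or.inl hcj) hs hs' with h1 | h1 | h1
        · exact h.ne (by omega) (by omega) (by omega) h1
        · exact h.ne (by omega) (by omega) (by omega) h1
        · exact h.ne (by omega) (by omega) (by omega) h1
      exact ih (by omega) (by omega) (by omega) _ c hψ' hT' h' hc'
        ((missing_kempeSwitch_of_not_mem hns).2 hcj)
    · exact IH _ hψ' hT' h' _ (mem_exitSet hi hij) _
        (mem_exitSet (i := i + 1) (by omega) (by omega)) (h.ne (by omega) (by omega) (by omega)) c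
        ⟨(missing_kempeSwitch_of_not_mem hs).2 hci, hc'⟩

/-- A colour `d` missing at the preceding outer vertex `f i` is played against `c`. If `f i` and `z`
are linked, the switch at `f j` makes it miss `d` like `f i`; otherwise the switch at `f i` makes it
miss `c` like `z`. -/
lemma false_of_missing_unused (hR : KempeClass G e₀ R)
    (hmax : ∀ ψ, R ψ → (W G ψ e₀).ncard ≤ S.ncard)
    (IH : ∀ ψ, R ψ → IsTashkinovTree G ψ e₀ S F → IsExitChain G S F a b m f g s t ψ →
      IsElementary G ψ (exitSet S f s j)) (hjt : j < t) (hj : s < j) (hψ : R ψ)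
    (hT : IsTashkinovTree G ψ e₀ S F) (h : IsExitChain G S F a b m f g s t ψ) {z : α}
    (hz : z ∈ S) (hcz : Missing G ψ c z) (hcj : Missing G ψ c (f j))
    (hcF : c ∉ usedColours ψ F) : False := by
  have hle := h.le
  obtain ⟨i, rfl⟩ : ∃ i, j = i + 1 := ⟨j - 1, by omega⟩
  have hφ := hR.colouring ψ hψ
  have hlink := h.chain.isLink i (by omega)
  obtain ⟨d, hd⟩ := hR.exists_missing (φ := ψ) hlink.left_mem
  have hel := IH ψ hψ hT h
  have hint := h.interior hφ (j := i) (by omega) (by omega)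
  have hint' := h.interior hφ (j := i + 1) (by omega) (by omega)
  have hdS := h.not_mem_missingColours hel (i := i) (by omega) (by omega) hjt.le hd
  have hcS : c ∈ missingColours G ψ S := ⟨z, hz, hcz⟩
  have hdc : d ≠ c := by
    rintro rfl
    exact hdS hcS
  -- Since `c` is missing at `z` and unused on the tree, all boundary edges of colour `d` lie in the
  -- component of `z`. A component from outside avoiding `z` thus never enters `S`.
  have hdisj : ∀ x ∉ S, ¬ SameComponent G ψ d c x z → ∀ w ∈ S, ¬ SameComponent G ψ d c x w := by
    intro x hx hxz w hw hs
    obtain ⟨e, u, v, he, hec, hu, hv, hxu⟩ := hs.exists_boundary hx hw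
    rcases hec with hec | hec
    · exact hxz (hxu.trans
        (hR.sameComponent_of_boundary hψ hT hmax hz hcz hcF hdS he hu hv hec).symm)
    · exact hv (hR.mem_of_missing hψ hT hmax hu he hec hcS)
  have hsw : ∀ x, IsExitChain G S F a b m f g s t (EdgeColouring.kempeSwitch G ψ d c x) := by
    intro x
    refine h.switch ?_ ?_ ?_ ?_ <;> rintro rfl
    exacts [hint.1 hd, hint.2 hd, hint'.1 hcj, hint'.2 hcj]
  have hiS := h.not_mem i (by omega) (by omega)
  have hjS := h.not_mem (i + 1) (by omega) (by omega)
  have hzi : z ≠ f i := fun hzi => hiS (hzi ▸ hz)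
  have hzj : z ≠ f (i + 1) := fun hzj => hjS (hzj ▸ hz)
  by_cases hs : SameComponent G ψ d c (f i) z
  · have hns : ¬ SameComponent G ψ d c (f (i + 1)) z := by
      intro hs'
      rcases hR.eq_or_eq_or_eq hψ (Or.inr hcz) (Or.inl hd) (Or.inr hcj) hs.symm hs'.symm
        with h1 | h1 | h1
      · exact hzi h1
      · exact hzj h1
      · exact h.ne (by omega) (by omega) (by omega) h1
    have hns' : ¬ SameComponent G ψ d c (f (i + 1)) (f i) := fun hs' => hns (hs'.trans hs)
    exact false_of_missing_outside hR hmax IH hjt (i := i) (by omega) (by omega) _ d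
      (hR.switch ψ d c (f (i + 1)) hψ hdc hlink.right_mem)
      (hT.kempeSwitch_of_disjoint (hdisj _ hjS hns)) (hsw _)
      ((missing_kempeSwitch_of_not_mem hns').2 hd)
      ((missing_kempeSwitch_left sameComponent_self).2 hcj)
  · exact IH _ (hR.switch ψ d c (f i) hψ hdc hlink.left_mem)
      (hT.kempeSwitch_of_disjoint (hdisj _ hiS hs)) (hsw _) z (Or.inl hz) (f i)
      (mem_exitSet (by omega) (by omega)) hzi c
      ⟨(missing_kempeSwitch_of_not_mem hs).2 hcz,
        (missing_kempeSwitch_right sameComponent_self).2 hd⟩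

/-- At the first outer vertex, switching `c` with `b` ends the chain at once. Later, `c` is first
replaced by a missing colour unused on the tree; components in two missing colours do not enter `S`.
-/
lemma false_of_missing_inside (hR : KempeClass G e₀ R)
    (hmax : ∀ ψ, R ψ → (W G ψ e₀).ncard ≤ S.ncard)
    (IH : ∀ ψ, R ψ → IsTashkinovTree G ψ e₀ S F → IsExitChain G S F a b m f g s t ψ →
      IsElementary G ψ (exitSet S f s j)) (hjt : j < t) (hj : s ≤ j) (hψ : R ψ)
    (hT : IsTashkinovTree G ψ e₀ S F) (h : IsExitChain G S F a b m f g s t ψ) {z : α}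
    (hz : z ∈ S) (hcz : Missing G ψ c z) (hcj : Missing G ψ c (f j)) : False := by
  have hle := h.le
  have hφ := hR.colouring ψ hψ
  have hint := h.interior hφ hj hjt
  have hfV := (h.chain.isLink j (by omega)).left_mem
  have hcS : c ∈ missingColours G ψ S := ⟨z, hz, hcz⟩
  have hcb : c ≠ b := by
    rintro rfl
    exact hint.2 hcj
  have hca : c ≠ a := by
    rintro rfl
    exact hint.1 hcj
  have hjS := h.not_mem j hj hjt
  rcases hj.eq_or_lt with rfl | hj
  · have hdisj := hR.not_sameComponent_of_missing hψ hT hmax hcS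
      ⟨f 0, h.mem 0 h.pos, h.missing⟩ hjS
    refine h.false_of_short hR hψ hT hmax hcb hfV hdisj le_rfl hjt (fun i hi => ?_)
      (Or.inr ((missing_kempeSwitch_right sameComponent_self).2 hcj))
    exact kempeSwitch_of_not_mem (h.chain.isLink i (by omega)).inc_left (hdisj _ (h.mem i hi))
  · obtain ⟨d, hdS, hdF, hdb⟩ := hR.exists_missing_unused hψ hT b
    rcases eq_or_ne c d with rfl | hcd
    · exact false_of_missing_unused hR hmax IH hjt hj hψ hT h hz hcz hcj hdF
    have hdisj := hR.not_sameComponent_of_missing hψ hT hmax hcS hdS hjS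
    have hda : d ≠ a := by
      rintro rfl
      exact h.not_missing hdS
    obtain ⟨w, hw, hdw⟩ := hdS
    refine false_of_missing_unused hR hmax IH hjt hj (hR.switch ψ c d (f j) hψ hcd hfV)
      (hT.kempeSwitch_of_disjoint hdisj) (h.switch hca hcb hda hdb) hw (c := d)
      ((missing_kempeSwitch_of_not_mem (hdisj w hw)).2 hdw)
      ((missing_kempeSwitch_right sameComponent_self).2 hcj) ?_
    rintro ⟨e, he, hed⟩
    obtain ⟨u, hu⟩ := hT.exists_inc he
    rw [kempeSwitch_of_not_mem hu (hdisj u (hT.edge_ends he hu))] at hed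
    exact hdF ⟨e, he, hed⟩

/-- The set `S` together with the outer segment of the chain is elementary. -/
theorem isElementary_exitSet (hR : KempeClass G e₀ R)
    (hmax : ∀ ψ, R ψ → (W G ψ e₀).ncard ≤ S.ncard) (hj : s ≤ j) (hjt : j ≤ t) :
    ∀ ψ, R ψ → IsTashkinovTree G ψ e₀ S F → IsExitChain G S F a b m f g s t ψ →
      IsElementary G ψ (exitSet S f s j) := by
  induction j, hj using Nat.le_induction with
  | base =>
    intro ψ hψ hT h x hx y hy
    have : exitSet S f s s = S := by
      unfold exitSet
      ext x
      simp only [Set.mem_union, Set.mem_ofPred_eq, or_iff_left_iff_imp]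
      rintro ⟨i, h1, h2, -⟩
      omega
    rw [this] at hx hy
    exact hR.isElementary_of_tree hψ hT x hx y hy
  | succ j hj ih =>
    have IH := ih (by omega)
    intro ψ hψ hT h
    have key : ∀ x ∈ exitSet S f s j, ∀ c, ¬ (Missing G ψ c x ∧ Missing G ψ c (f j)) := by
      rintro x (hx | ⟨i, hi, hij, rfl⟩) c ⟨hcx, hcj⟩
      · exact false_of_missing_inside hR hmax IH (by omega) hj hψ hT h hx hcx hcj
      · exact false_of_missing_outside hR hmax IH (by omega) hi hij ψ c hψ hT h hcx hcj
    have hsplit : ∀ x ∈ exitSet S f s (j + 1), x ∈ exitSet S f s j ∨ x = f j := by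
      rintro x (hx | ⟨i, hi, hij, rfl⟩)
      · exact Or.inl (Or.inl hx)
      · rcases (Nat.lt_succ_iff.1 hij).eq_or_lt with rfl | hij
        · exact Or.inr rfl
        · exact Or.inl (mem_exitSet hi hij)
    intro x hx y hy hxy c hc
    rcases hsplit x hx with hx | rfl <;> rcases hsplit y hy with hy | rfl
    · exact IH ψ hψ hT h x hx y hy hxy c hc
    · exact key x hx c hc
    · exact key y hy c hc.symm
    · exact hxy rfl

end IsExitChain

end Exit

end EdgeColouring

namespace EdgeColouring

/-! ### Density and colour classes -/

section Density

variable {α β : Type*} {k : ℕ} {G : Graph α β} {φ : β → Option (Fin k)} {S : Set α} {c : Fin k}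

/-- The edges of colour `c` with both ends in `S`. -/
def insideEdges (G : Graph α β) (φ : β → Option (Fin k)) (S : Set α) (c : Fin k) : Set β :=
  {e | e ∈ (G.induce S).edgeSet ∧ φ e = some c}

lemma edgeSet_induce_subset : (G.induce S).edgeSet ⊆ G.edgeSet := by
  rintro e ⟨x, y, h, -⟩
  exact h.edge_mem

/-- Double counting of the incidences between the vertices of `S` and the edges of colour `c`. -/
lemma ncard_not_missing_eq [G.Loopless] (hE : G.edgeSet.Finite) (hS : S.Finite)
    (hφ : IsPartialColouring G φ) (c : Fin k) :
    {x ∈ S | ¬ Missing G φ c x}.ncard =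
      2 * (insideEdges G φ S c).ncard + (boundaryEdges G φ S c).ncard := by
  classical
  have hA : {x ∈ S | ¬ Missing G φ c x}.Finite := hS.subset fun x hx => hx.1
  have hI : (insideEdges G φ S c).Finite := hE.subset fun e he => edgeSet_induce_subset he.1
  have hB : (boundaryEdges G φ S c).Finite := by
    refine hE.subset ?_
    rintro e ⟨-, x, -, y, -, h⟩
    exact h.edge_mem
  have hdisj : Disjoint hI.toFinset hB.toFinset := by
    rw [Finset.disjoint_left]
    intro e he he'
    obtain ⟨⟨u, v, huv, hu, hv⟩, -⟩ := hI.mem_toFinset.1 he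
    obtain ⟨-, x, hx, y, hy, hxy⟩ := hB.mem_toFinset.1 he'
    rcases hxy.inc_right.eq_or_eq_of_isLink huv with rfl | rfl
    · exact hy hu
    · exact hy hv
  have hmemA : ∀ e x, φ e = some c → G.Inc e x → x ∈ S → x ∈ hA.toFinset := by
    intro e x hc he hx
    exact hA.mem_toFinset.2 ⟨hx, fun hm => hm e he hc⟩
  have h1 := Finset.sum_card_bipartiteAbove_eq_sum_card_bipartiteBelow (s := hA.toFinset)
    (t := hI.toFinset ∪ hB.toFinset) (fun x e => G.Inc e x)
  have hl : ∀ x ∈ hA.toFinset,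
      (Finset.bipartiteAbove (fun x e => G.Inc e x) (hI.toFinset ∪ hB.toFinset) x).card = 1 := by
    intro x hx
    obtain ⟨hxS, hm⟩ := hA.mem_toFinset.1 hx
    unfold Missing at hm
    push Not at hm
    obtain ⟨e, he, hc⟩ := hm
    rw [Finset.card_eq_one]
    refine ⟨e, ?_⟩
    ext e'
    rw [Finset.mem_bipartiteAbove, Finset.mem_singleton, Finset.mem_union, hI.mem_toFinset,
      hB.mem_toFinset]
    constructor
    · rintro ⟨he', he'x⟩
      have hc' : φ e' = some c := he'.elim (fun h => h.2) fun h => h.1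
      exact hφ.eq_of_inc he'x he hc' hc
    · rintro rfl
      refine ⟨?_, he⟩
      obtain ⟨y, hxy⟩ := he
      by_cases hy : y ∈ S
      · exact Or.inl ⟨⟨x, y, hxy, hxS, hy⟩, hc⟩
      · exact Or.inr ⟨hc, x, hxS, y, hy, hxy⟩
  have hrI : ∀ e ∈ hI.toFinset,
      (Finset.bipartiteBelow (fun x e => G.Inc e x) hA.toFinset e).card = 2 := by
    intro e he
    obtain ⟨⟨u, v, huv, hu, hv⟩, hc⟩ := hI.mem_toFinset.1 he
    rw [Finset.card_eq_two]
    refine ⟨u, v, huv.ne, ?_⟩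
    ext x
    rw [Finset.mem_bipartiteBelow, Finset.mem_insert, Finset.mem_singleton]
    constructor
    · rintro ⟨-, hx⟩
      exact hx.eq_or_eq_of_isLink huv
    · rintro (rfl | rfl)
      · exact ⟨hmemA e _ hc huv.inc_left hu, huv.inc_left⟩
      · exact ⟨hmemA e _ hc huv.inc_right hv, huv.inc_right⟩
  have hrB : ∀ e ∈ hB.toFinset,
      (Finset.bipartiteBelow (fun x e => G.Inc e x) hA.toFinset e).card = 1 := by
    intro e he
    obtain ⟨hc, u, hu, v, hv, huv⟩ := hB.mem_toFinset.1 he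
    rw [Finset.card_eq_one]
    refine ⟨u, ?_⟩
    ext x
    rw [Finset.mem_bipartiteBelow, Finset.mem_singleton]
    constructor
    · rintro ⟨hxA, hx⟩
      rcases hx.eq_or_eq_of_isLink huv with rfl | rfl
      · rfl
      · exact (hv (hA.mem_toFinset.1 hxA).1).elim
    · rintro rfl
      exact ⟨hmemA e _ hc huv.inc_left hu, huv.inc_left⟩
  rw [Finset.sum_congr rfl hl, Finset.sum_union hdisj, Finset.sum_congr rfl hrI,
    Finset.sum_congr rfl hrB, Finset.sum_const, Finset.sum_const, Finset.sum_const, smul_eq_mul,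
    smul_eq_mul, smul_eq_mul, mul_one, mul_one] at h1
  rw [Set.ncard_eq_toFinset_card _ hA, Set.ncard_eq_toFinset_card _ hI,
    Set.ncard_eq_toFinset_card _ hB, h1, mul_comm]

lemma ncard_edgeSet_induce (hE : G.edgeSet.Finite) :
    (G.induce S).edgeSet.ncard = {e | e ∈ (G.induce S).edgeSet ∧ φ e = none}.ncard +
      ∑ c, (insideEdges G φ S c).ncard := by
  classical
  have hfin : (G.induce S).edgeSet.Finite := hE.subset edgeSet_induce_subset
  have h1 := Finset.card_eq_sum_card_fiberwise (s := hfin.toFinset) (f := φ) (t := Finset.univ)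
    (fun _ _ => by simp)
  rw [Fintype.sum_option] at h1
  rw [Set.ncard_eq_toFinset_card _ hfin, h1]
  have key : ∀ o, (hfin.toFinset.filter fun e => φ e = o).card =
      {e | e ∈ (G.induce S).edgeSet ∧ φ e = o}.ncard := by
    intro o
    rw [← Set.ncard_coe_finset]
    congr 1
    ext e
    simp
  rw [key]
  congr 1
  exact Finset.sum_congr rfl fun c _ => key _

lemma induce_induce_edgeSet {S' : Set α} (h : S' ⊆ S) :
    ((G.induce S).induce S').edgeSet = (G.induce S').edgeSet := by
  ext e
  constructor
  · rintro ⟨x, y, ⟨hxy, -⟩, hx, hy⟩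
    exact ⟨x, y, hxy, hx, hy⟩
  · rintro ⟨x, y, hxy, hx, hy⟩
    exact ⟨x, y, ⟨hxy, h hx, h hy⟩, hx, hy⟩

lemma le_density_induce (hS : S.Finite) (hodd : Odd S.ncard) (h3 : 3 ≤ S.ncard) :
    2 * ((G.induce S).edgeSet.ncard : ℝ) / ((S.ncard : ℝ) - 1) ≤ density (G.induce S) := by
  unfold density
  refine le_csSup ?_ ⟨S, subset_rfl, hodd, h3, by rw [induce_induce_edgeSet subset_rfl]⟩
  refine ((hS.finite_subsets.image fun S' =>
    2 * (((G.induce S).induce S').edgeSet.ncard : ℝ) / ((S'.ncard : ℝ) - 1)).subset ?_).bddAbove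
  rintro r ⟨S', hS', -, -, rfl⟩
  exact ⟨S', hS', rfl⟩

/-- The chromatic index is at least the density of every induced subgraph. -/
lemma density_induce_le_chromaticIndex [G.Loopless] (hE : G.edgeSet.Finite) (hS : S.Finite)
    (hχ : 0 < chromaticIndex G) : density (G.induce S) ≤ chromaticIndex G := by
  obtain ⟨θ, hθ, hall⟩ : ∃ θ : β → Option (Fin (chromaticIndex G)),
      IsPartialColouring G θ ∧ ∀ e ∈ G.edgeSet, θ e ≠ none :=
    -- Positivity excludes the default value `0` of the infimum of the empty set.
    Nat.sInf_mem (Nat.nonempty_of_pos_sInf hχ)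
  refine Real.sSup_le ?_ (Nat.cast_nonneg _)
  rintro r ⟨S', hS', hodd, h3, rfl⟩
  change S' ⊆ S at hS'
  have hpos : (0 : ℝ) < (S'.ncard : ℝ) - 1 := by
    have : (3 : ℝ) ≤ S'.ncard := by exact_mod_cast h3
    linarith
  have hfin : S'.Finite := hS.subset hS'
  rw [div_le_iff₀ hpos, induce_induce_edgeSet hS', ncard_edgeSet_induce hE (φ := θ)]
  have hnone : {e | e ∈ (G.induce S').edgeSet ∧ θ e = none} = ∅ := by
    ext e
    simp only [Set.mem_ofPred_eq, Set.mem_empty_iff_false, iff_false, not_and]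
    exact fun he => hall e (edgeSet_induce_subset he)
  rw [hnone, Set.ncard_empty, zero_add]
  -- A colour class inside a set of odd size misses at least one vertex.
  have hc : ∀ c, 2 * (insideEdges G θ S' c).ncard ≤ S'.ncard - 1 := by
    intro c
    have h1 := ncard_not_missing_eq hE hfin hθ c
    have h2 : {x ∈ S' | ¬ Missing G θ c x}.ncard ≤ S'.ncard :=
      Set.ncard_le_ncard (fun x hx => hx.1) hfin
    obtain ⟨d, hd⟩ := hodd
    omega
  have hsum : 2 * ∑ c, (insideEdges G θ S' c).ncard ≤ chromaticIndex G * (S'.ncard - 1) := by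
    rw [Finset.mul_sum]
    refine (Finset.sum_le_card_nsmul _ _ _ fun c _ => hc c).trans ?_
    simp
  have hcast : ((S'.ncard - 1 : ℕ) : ℝ) = (S'.ncard : ℝ) - 1 := by
    rw [Nat.cast_sub (by omega), Nat.cast_one]
  rw [← hcast]
  exact_mod_cast hsum

end Density

/-! ### Parity of the boundary and existence of defective colours -/

section Defective

variable {α β : Type*} {k : ℕ} {G : Graph α β} {φ : β → Option (Fin k)} {e₀ : β}
  {R : (β → Option (Fin k)) → Prop} {a c : Fin k}

lemma boundaryEdges_W_eq_empty (hc : c ∈ missingColours G φ (W G φ e₀)) :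
    boundaryEdges G φ (W G φ e₀) c = ∅ := by
  ext e
  simp only [Set.mem_empty_iff_false, iff_false]
  rintro ⟨hec, x, hx, y, hy, hxy⟩
  exact hy (mem_W_of_missing hx hxy hec hc)

lemma not_mem_missingColours_of_defective (ha : a ∈ defectiveColours G φ (W G φ e₀)) :
    a ∉ missingColours G φ (W G φ e₀) := by
  intro h
  have h1 : 1 < (boundaryEdges G φ (W G φ e₀) a).ncard := ha
  rw [boundaryEdges_W_eq_empty h, Set.ncard_empty] at h1
  omega

namespace KempeClass

lemma isElementary_W (hR : KempeClass G e₀ R) (hφ : R φ) (he₀ : e₀ ∈ G.edgeSet) :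
    IsElementary G φ (W G φ e₀) := by
  obtain ⟨T, hT⟩ := exists_isMaximalTashkinovTree (φ := φ) hR.finite_vertexSet hR.finite_edgeSet he₀
  rw [← hT.fst_eq_W]
  exact hR.isElementary_of_tree hφ hT.prop

lemma finite_W (hR : KempeClass G e₀ R) : (W G φ e₀).Finite :=
  hR.finite_vertexSet.subset W_subset_vertexSet

/-- No edge of colour `c` leaves `W`, and by elementarity only one vertex misses `c`; the edges of
colour `c` match all the others inside `W`. -/
lemma ncard_W_of_missing (hR : KempeClass G e₀ R) (hφ : R φ) (he₀ : e₀ ∈ G.edgeSet)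
    (hc : c ∈ missingColours G φ (W G φ e₀)) :
    (W G φ e₀).ncard = 2 * (insideEdges G φ (W G φ e₀) c).ncard + 1 := by
  have := hR.loopless
  have h1 := ncard_not_missing_eq hR.finite_edgeSet (hR.finite_W (φ := φ)) (hR.colouring φ hφ) c
  rw [boundaryEdges_W_eq_empty hc, Set.ncard_empty, add_zero] at h1
  obtain ⟨v, hv, hcv⟩ := hc
  rw [← h1, ← Set.ncard_sdiff_singleton_add_one hv hR.finite_W]
  congr 2
  ext x
  simp only [Set.mem_sdiff, Set.mem_singleton_iff, Set.mem_ofPred_eq]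
  refine and_congr_right fun hx => ⟨fun hne hm => ?_, fun hm hxv => hm (hxv ▸ hcv)⟩
  exact hR.isElementary_W hφ he₀ x hx v hv hne c ⟨hm, hcv⟩

lemma ncard_W_of_not_missing (hR : KempeClass G e₀ R) (hφ : R φ)
    (hc : c ∉ missingColours G φ (W G φ e₀)) :
    (W G φ e₀).ncard = 2 * (insideEdges G φ (W G φ e₀) c).ncard +
      (boundaryEdges G φ (W G φ e₀) c).ncard := by
  have := hR.loopless
  rw [← ncard_not_missing_eq hR.finite_edgeSet (hR.finite_W (φ := φ)) (hR.colouring φ hφ) c]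
  congr 1
  ext x
  simp only [Set.mem_ofPred_eq]
  exact ⟨fun hx => ⟨hx, fun hm => hc ⟨x, hx, hm⟩⟩, fun hx => hx.1⟩

lemma odd_ncard_W (hR : KempeClass G e₀ R) (hφ : R φ) (he₀ : e₀ ∈ G.edgeSet) :
    Odd (W G φ e₀).ncard := by
  obtain ⟨x, y, hxy⟩ := G.exists_isLink_of_mem_edgeSet he₀
  obtain ⟨c, hc⟩ := hR.exists_missing (φ := φ) hxy.left_mem
  have hx : x ∈ W G φ e₀ := MemW.start x hxy.inc_left
  exact ⟨_, hR.ncard_W_of_missing hφ he₀ ⟨x, hx, hc⟩⟩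

lemma three_le_ncard_W (hR : KempeClass G e₀ R) (hφ : R φ) (he₀ : e₀ ∈ G.edgeSet) :
    3 ≤ (W G φ e₀).ncard := by
  have := hR.loopless
  obtain ⟨x, y, hxy⟩ := G.exists_isLink_of_mem_edgeSet he₀
  obtain ⟨d, hd⟩ := hR.odd_ncard_W hφ he₀
  have h2 : 1 < (W G φ e₀).ncard := (Set.one_lt_ncard hR.finite_W).2
    ⟨x, MemW.start x hxy.inc_left, y, MemW.start y hxy.inc_right, hxy.ne⟩
  omega

lemma odd_ncard_boundary (hR : KempeClass G e₀ R) (hφ : R φ) (he₀ : e₀ ∈ G.edgeSet)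
    (hc : c ∉ missingColours G φ (W G φ e₀)) : Odd (boundaryEdges G φ (W G φ e₀) c).ncard := by
  have h1 := hR.ncard_W_of_not_missing hφ hc
  have h2 := hR.odd_ncard_W hφ he₀
  rw [h1, Nat.odd_add] at h2
  rw [← Nat.not_even_iff_odd] at h2 ⊢
  exact fun h => h2.2 h (even_two_mul _)

/-- Without defective colours the density of the subgraph induced by `W` exceeds the number of
colours. -/
lemma lt_density_of_defectiveColours_eq_empty (hR : KempeClass G e₀ R) (hφ : R φ)
    (he₀ : e₀ ∈ G.edgeSet) (h : defectiveColours G φ (W G φ e₀) = ∅) :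
    (k : ℝ) < density (G.induce (W G φ e₀)) := by
  have h3 := hR.three_le_ncard_W hφ he₀
  have hodd := hR.odd_ncard_W hφ he₀
  have hfinW : (W G φ e₀).Finite := hR.finite_W
  refine lt_of_lt_of_le ?_ (le_density_induce hfinW hodd h3)
  have hpos : (0 : ℝ) < ((W G φ e₀).ncard : ℝ) - 1 := by
    have : (3 : ℝ) ≤ (W G φ e₀).ncard := by exact_mod_cast h3
    linarith
  rw [lt_div_iff₀ hpos]
  -- A colour not missing in `W` has an odd number of boundary edges, hence exactly one if it is not
  -- defective.
  have hc : ∀ c, 2 * (insideEdges G φ (W G φ e₀) c).ncard = (W G φ e₀).ncard - 1 := by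
    intro c
    by_cases hc : c ∈ missingColours G φ (W G φ e₀)
    · have := hR.ncard_W_of_missing hφ he₀ hc
      omega
    · have h1 := hR.ncard_W_of_not_missing hφ hc
      have h2 : ¬ 1 < (boundaryEdges G φ (W G φ e₀) c).ncard := fun h' => by
        have : c ∈ defectiveColours G φ (W G φ e₀) := h'
        rw [h] at this
        exact this
      obtain ⟨d, hd⟩ := hR.odd_ncard_boundary hφ he₀ hc
      omega
  -- The uncoloured edge `e₀` inside `W` makes the inequality strict.
  have hnone : 1 ≤ {e | e ∈ (G.induce (W G φ e₀)).edgeSet ∧ φ e = none}.ncard := by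
    rw [Nat.one_le_iff_ne_zero, ne_eq, Set.ncard_eq_zero
      (hR.finite_edgeSet.subset fun e he => edgeSet_induce_subset he.1), ← ne_eq,
      ← Set.nonempty_iff_ne_empty]
    obtain ⟨x, y, hxy⟩ := G.exists_isLink_of_mem_edgeSet he₀
    exact ⟨e₀, ⟨x, y, hxy, MemW.start x hxy.inc_left, MemW.start y hxy.inc_right⟩,
      hR.uncoloured φ hφ⟩
  have hE := ncard_edgeSet_induce hR.finite_edgeSet (φ := φ) (S := W G φ e₀)
  have hsum : 2 * ∑ c, (insideEdges G φ (W G φ e₀) c).ncard = k * ((W G φ e₀).ncard - 1) := by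
    rw [Finset.mul_sum, Finset.sum_congr rfl fun c _ => hc c]
    simp
  have hlt : k * ((W G φ e₀).ncard - 1) < 2 * (G.induce (W G φ e₀)).edgeSet.ncard := by omega
  have hcast : (((W G φ e₀).ncard - 1 : ℕ) : ℝ) = ((W G φ e₀).ncard : ℝ) - 1 := by
    rw [Nat.cast_sub (by omega), Nat.cast_one]
  rw [← hcast]
  exact_mod_cast hlt

end KempeClass

lemma ncard_incidenceSet_le_maxDegree (hV : G.vertexSet.Finite) {x : α} (hx : x ∈ G.vertexSet) :
    (G.incidenceSet x).ncard ≤ maxDegree G := by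
  refine le_csSup ?_ ⟨x, hx, rfl⟩
  refine ((hV.image fun x => (G.incidenceSet x).ncard).subset ?_).bddAbove
  rintro d ⟨x, hx, rfl⟩
  exact ⟨x, hx, rfl⟩

lemma KempeReachable.isPartialColouring {ψ : β → Option (Fin k)} (h : KempeReachable G φ ψ)
    (hφ : IsPartialColouring G φ) : IsPartialColouring G ψ := by
  induction h with
  | refl => exact hφ
  | tail _ h ih =>
    obtain ⟨_, _, _, -, -, rfl⟩ := h
    exact ih.kempeSwitch

lemma KempeReachable.eq_none {ψ : β → Option (Fin k)} (h : KempeReachable G φ ψ)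
    (hφ : φ e₀ = none) : ψ e₀ = none := by
  induction h with
  | refl => exact hφ
  | tail _ h ih =>
    obtain ⟨_, _, _, -, -, rfl⟩ := h
    exact kempeSwitch_eq_none_iff.2 ih

lemma kempeClass_kempeReachable [G.Loopless] (hV : G.vertexSet.Finite) (hE : G.edgeSet.Finite)
    (hk : maxDegree G + 1 ≤ k) (hφ : IsPartialColouring G φ) (hφe₀ : φ e₀ = none)
    (h1 : ¬ ∃ ψ : β → Option (Fin k), KempeReachable G φ ψ ∧
      ∃ c, ∀ x, G.Inc e₀ x → Missing G ψ c x) : KempeClass G e₀ (KempeReachable G φ) where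
  loopless := inferInstance
  finite_vertexSet := hV
  finite_edgeSet := hE
  degree_lt _ hx := (ncard_incidenceSet_le_maxDegree hV hx).trans_lt hk
  colouring _ hψ := hψ.isPartialColouring hφ
  uncoloured _ hψ := hψ.eq_none hφe₀
  switch _ a b _ hψ hab hx := hψ.tail ⟨a, b, _, hab, hx, rfl⟩
  ends ψ hψ hc := h1 ⟨ψ, hψ, hc⟩

end Defective

end EdgeColouring

namespace EdgeColouring

/-! ### Splitting lists at a vertex -/

section Lists

variable {α : Type*}

lemma mem_of_mem_takeWhile_append {p : α → Bool} {A B : List α} {c x : α} (hc : p c = false)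
    (hx : x ∈ (A ++ c :: B).takeWhile p) : x ∈ A := by
  induction A with
  | nil => simp [hc] at hx
  | cons a A ih =>
    rw [List.cons_append, List.takeWhile_cons] at hx
    split_ifs at hx
    · rcases List.mem_cons.1 hx with rfl | hx
      · exact List.mem_cons_self
      · exact List.mem_cons_of_mem _ (ih hx)
    · cases hx

lemma dropWhile_append_cons {p : α → Bool} {A B : List α} {c : α} (hA : ∀ x ∈ A, p x = true)
    (hc : p c = false) : (A ++ c :: B).dropWhile p = c :: B := by
  induction A with
  | nil => simp [hc]
  | cons a A ih =>
    rw [List.cons_append, List.dropWhile_cons, if_pos (hA a List.mem_cons_self)]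
    exact ih fun x hx => hA x (List.mem_cons_of_mem _ hx)

end Lists

/-! ### Paths as lists and as chains; uniqueness -/

section PathData

variable {α β : Type*} {k : ℕ} {G : Graph α β} {φ : β → Option (Fin k)} {a b : Fin k} {m n : ℕ}
  {f f' : ℕ → α} {g g' : ℕ → β} {S : Set α}

/-- The path with vertices `f 0, …, f m` and edges `g 0, …, g (m - 1)`. -/
def PathData.ofChain (m : ℕ) (f : ℕ → α) (g : ℕ → β) : PathData α β :=
  ⟨(List.range (m + 1)).map f, (List.range m).map g⟩

lemma IsChain.isMaximalAlternatingPath [G.Loopless] (h : IsChain G φ a b m f g)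
    (hc : IsClosedChain G φ a b m f g) (hφ : IsPartialColouring G φ) (h0 : f 0 ∈ G.vertexSet) :
    IsMaximalAlternatingPath G φ a b (PathData.ofChain m f g) where
  isPath :=
    { length_eq := by simp [PathData.ofChain]
      nodup := by
        refine List.Nodup.map_on (fun i hi j hj hij => ?_) List.nodup_range
        rw [List.mem_range] at hi hj
        exact h.inj i (by omega) j (by omega) hij
      subset := by
        intro x hx
        obtain ⟨i, hi, rfl⟩ := List.mem_map.1 hx
        rw [List.mem_range] at hi
        rcases Nat.eq_zero_or_pos i with rfl | hi0
        · exact h0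
        · have := (h.isLink (i - 1) (by omega)).right_mem
          rwa [Nat.sub_add_cancel hi0] at this
      isLink := by
        intro i hi
        have : i < m := by simpa [PathData.ofChain] using hi
        simpa [PathData.ofChain] using h.isLink i this
      colour := by
        intro e he
        obtain ⟨i, hi, rfl⟩ := List.mem_map.1 he
        exact h.colour i (List.mem_range.1 hi)
      alternate := by
        intro i hi
        have : i + 1 < m := by simpa [PathData.ofChain] using hi
        simpa [PathData.ofChain] using h.colour_ne hφ this }
  maximal := by
    intro e x hx he hec
    obtain ⟨i, hi, rfl⟩ := List.mem_map.1 hx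
    rw [List.mem_range] at hi
    obtain ⟨j, hj, rfl⟩ := hc i (by omega) e he hec
    exact List.mem_map.2 ⟨j, List.mem_range.2 hj, rfl⟩

lemma IsMaximalAlternatingPath.exists_chain {P : PathData α β}
    (h : IsMaximalAlternatingPath G φ a b P) (e₀ : β) :
    ∃ m f g, IsChain G φ a b m f g ∧ IsClosedChain G φ a b m f g ∧
      P = PathData.ofChain m f g := by
  have hlen := h.isPath.length_eq
  have hv : 0 < P.verts.length := by omega
  have hf : ∀ (i : ℕ) (hi : i < P.verts.length), P.verts.getD i (P.verts[0]) = P.verts[i] :=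
    fun i hi => by simp [hi]
  have hg : ∀ (i : ℕ) (hi : i < P.edges.length), P.edges.getD i e₀ = P.edges[i] :=
    fun i hi => by simp [hi]
  refine ⟨P.edges.length, fun i => P.verts.getD i (P.verts[0]), fun i => P.edges.getD i e₀,
    ⟨?_, ?_, ?_⟩, ?_, ?_⟩
  · intro i hi j hj hij
    rw [hf i (by omega), hf j (by omega)] at hij
    exact (h.isPath.nodup.getElem_inj_iff).1 hij
  · intro i hi
    rw [hf i (by omega), hf (i + 1) (by omega), hg i hi]
    exact h.isPath.isLink i hi
  · intro i hi
    rw [hg i hi]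
    exact h.isPath.colour _ (List.getElem_mem _)
  · intro i hi e he hc
    dsimp only at he ⊢
    rw [hf i (by omega)] at he
    obtain ⟨j, hj, rfl⟩ := List.mem_iff_getElem.1
      (h.maximal e _ (List.getElem_mem _) he hc)
    exact ⟨j, hj, (hg j hj).symm⟩
  · obtain ⟨verts, edges⟩ := P
    simp only at hlen hf hg
    simp only [PathData.ofChain, PathData.mk.injEq]
    constructor
    · refine List.ext_getElem (by simp [hlen]) fun i h1 h2 => ?_
      rw [List.getElem_map, List.getElem_range, hf i h1]
    · refine List.ext_getElem (by simp) fun i h1 h2 => ?_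
      rw [List.getElem_map, List.getElem_range, hg i h1]

/-- The missing colour determines the first edge; thereafter each edge has the colour different from
that of its predecessor, so properness determines it. -/
lemma IsChain.eq_of_closed_aux (h : IsChain G φ a b m f g) (h' : IsChain G φ a b n f' g')
    (hφ : IsPartialColouring G φ) (h0 : Missing G φ a (f 0) ∨ Missing G φ b (f 0))
    (hff : f 0 = f' 0) {i : ℕ} (him : i ≤ m) (hin : i ≤ n) :
    f i = f' i ∧ ∀ j < i, g j = g' j := by
  induction i with
  | zero => exact ⟨hff, fun j hj => by omega⟩
  | succ i ih =>
    obtain ⟨hfi, hgi⟩ := ih (by omega) (by omega)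
    have h1 := h.isLink i him
    have h2 := h'.isLink i hin
    have hg : g i = g' i := by
      rcases Nat.eq_zero_or_pos i with rfl | hi0
      · exact eq_edge_of_missing hφ h0 h1.inc_left (hff ▸ h2.inc_left) (h.colour 0 him)
          (h'.colour 0 hin)
      · obtain ⟨l, rfl⟩ : ∃ l, i = l + 1 := ⟨i - 1, by omega⟩
        have c1 := h.colour_ne hφ him
        have c2 := h'.colour_ne hφ hin
        rw [hgi l (by omega)] at c1
        have d0 := h'.colour l (by omega)
        have d1 := h.colour (l + 1) him
        have d2 := h'.colour (l + 1) hin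
        have heq : φ (g (l + 1)) = φ (g' (l + 1)) := by
          rcases d0 with d0 | d0 <;> rcases d1 with d1 | d1 <;> rcases d2 with d2 | d2 <;> simp_all
        rw [hfi] at h1
        rcases d1 with d1 | d1 <;>
        exact hφ.eq_of_inc h1.inc_left h2.inc_left d1 (heq ▸ d1)
    refine ⟨?_, fun j hj => ?_⟩
    · rw [← hg, ← hfi] at h2
      exact h1.right_unique h2
    · rcases (Nat.lt_succ_iff.1 hj).eq_or_lt with rfl | hj
      · exact hg
      · exact hgi j hj

/-- A longer chain would leave `f m` by an edge that, by closedness, has already been traversed. -/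
lemma IsChain.le_of_closed (h : IsChain G φ a b m f g) (h' : IsChain G φ a b n f' g')
    (hc : IsClosedChain G φ a b m f g) (hφ : IsPartialColouring G φ)
    (h0 : Missing G φ a (f 0) ∨ Missing G φ b (f 0)) (hff : f 0 = f' 0) : n ≤ m := by
  by_contra! hmn
  obtain ⟨hfm, hgm⟩ := h.eq_of_closed_aux h' hφ h0 hff le_rfl hmn.le
  have h1 := h'.isLink m hmn
  obtain ⟨j, hj, hj'⟩ := hc m le_rfl (g' m) (hfm ▸ h1.inc_left) (h'.colour m hmn)
  rw [hgm j hj] at hj'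
  rw [hj'] at h1
  rcases h1.inc_right.eq_or_eq_of_isLink (h'.isLink j (by omega)) with h2 | h2
  · have := h'.inj _ (by omega) _ (by omega) h2
    omega
  · have := h'.inj _ (by omega) _ (by omega) h2
    omega

/-- A maximal alternating path is determined by its first vertex, if this is an end of the path. -/
lemma IsChain.ofChain_eq (h : IsChain G φ a b m f g) (h' : IsChain G φ a b n f' g')
    (hc : IsClosedChain G φ a b m f g) (hc' : IsClosedChain G φ a b n f' g')
    (hφ : IsPartialColouring G φ) (h0 : Missing G φ a (f 0) ∨ Missing G φ b (f 0))
    (hff : f 0 = f' 0) : PathData.ofChain n f' g' = PathData.ofChain m f g := by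
  obtain rfl : n = m := (h.le_of_closed h' hc hφ h0 hff).antisymm
    (h'.le_of_closed h hc' hφ (hff ▸ h0) hff.symm)
  have key := fun i (hi : i ≤ n) => h.eq_of_closed_aux h' hφ h0 hff hi hi
  simp only [PathData.ofChain, PathData.mk.injEq]
  constructor
  · refine List.map_congr_left fun i hi => ?_
    rw [List.mem_range] at hi
    exact (key i (by omega)).1.symm
  · refine List.map_congr_left fun i hi => ?_
    rw [List.mem_range] at hi
    exact ((key n le_rfl).2 i hi).symm

/-- The first vertex of a path that is a whole component misses one of the colours. -/
lemma IsChain.missing_start (h : IsChain G φ a b m f g) (hc : IsClosedChain G φ a b m f g)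
    (hab : a ≠ b) : Missing G φ a (f 0) ∨ Missing G φ b (f 0) := by
  by_contra! hne
  unfold Missing at hne
  push Not at hne
  obtain ⟨⟨e, he, hea⟩, ⟨e', he', heb⟩⟩ := hne
  have key : ∀ j < m, G.Inc (g j) (f 0) → j = 0 := by
    intro j hj hinc
    rcases hinc.eq_or_eq_of_isLink (h.isLink j hj) with h1 | h1
    · exact (h.inj _ (by omega) _ (by omega) h1).symm
    · have := h.inj _ (by omega) _ (by omega) h1
      omega
  obtain ⟨j, hj, rfl⟩ := hc 0 (by omega) e he (Or.inl hea)
  obtain ⟨j', hj', rfl⟩ := hc 0 (by omega) e' he' (Or.inr heb)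
  rw [key j hj he] at hea
  rw [key j' hj' he', hea, Option.some.injEq] at heb
  exact hab heb

lemma outsideVerts_ofChain {s : ℕ} (hs : ∀ i < s, f i ∈ S) (hsm : s + 1 ≤ m) (h1 : f s ∉ S)
    (h2 : f (s + 1) ∉ S) :
    ∃ l, outsideVerts S (PathData.ofChain m f g) = f s :: f (s + 1) :: l := by
  classical
  have hr : List.range (m + 1) = List.range' 0 s ++ s :: (s + 1) :: List.range' (s + 1 + 1)
      (m - 1 - s) := by
    rw [← List.range'_succ, ← List.range'_succ, List.range_eq_range']
    have := List.range'_append_1 (s := 0) (m := s) (n := m - 1 - s + 1 + 1)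
    rw [Nat.zero_add] at this
    rw [this]
    congr 1
    omega
  refine ⟨((List.range' (s + 1 + 1) (m - 1 - s)).map f).filter fun x => decide (x ∉ S), ?_⟩
  unfold outsideVerts PathData.ofChain
  simp only
  rw [hr, List.map_append, List.filter_append, List.map_cons, List.map_cons,
    List.filter_cons_of_pos (by simpa using h1), List.filter_cons_of_pos (by simpa using h2),
    List.filter_eq_nil_iff.2, List.nil_append]
  intro x hx
  obtain ⟨i, hi, rfl⟩ := List.mem_map.1 hx
  rw [List.mem_range'_1] at hi
  simpa using hs i (by omega)

lemma exists_of_mem_outsideSegment {s t : ℕ} {x : α} (hs : ∀ i < s, f i ∈ S) (h1 : f s ∉ S)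
    (hst : s < t) (htm : t ≤ m) (h2 : f t ∈ S)
    (hx : x ∈ outsideSegment S (PathData.ofChain m f g)) : ∃ i, s ≤ i ∧ i < t ∧ x = f i := by
  classical
  have hr : List.range (m + 1) =
      List.range' 0 s ++ (s :: List.range' (s + 1) (t - s - 1) ++ t :: List.range' (t + 1)
        (m - t)) := by
    rw [← List.range'_succ, ← List.range'_succ, List.range_eq_range']
    have e1 := List.range'_append_1 (s := s) (m := t - s - 1 + 1) (n := m - t + 1)
    have e2 := List.range'_append_1 (s := 0) (m := s) (n := t - s - 1 + 1 + (m - t + 1))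
    rw [Nat.zero_add] at e2
    rw [show s + (t - s - 1 + 1) = t by omega] at e1
    rw [e1, e2]
    congr 1
    omega
  unfold outsideSegment PathData.ofChain at hx
  simp only at hx
  rw [hr, List.map_append, List.map_append, List.map_cons, List.cons_append,
    dropWhile_append_cons (by
      intro y hy
      obtain ⟨i, hi, rfl⟩ := List.mem_map.1 hy
      rw [List.mem_range'_1] at hi
      simpa using hs i (by omega)) (by simpa using h1), ← List.cons_append, ← List.map_cons,
    List.map_cons (l := List.range' (t + 1) (m - t))] at hx
  obtain ⟨i, hi, rfl⟩ := List.mem_map.1 (mem_of_mem_takeWhile_append (by simpa using h2) hx)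
  rw [← List.range'_succ, List.mem_range'_1] at hi
  exact ⟨i, by omega, by omega, rfl⟩

end PathData

lemma IsElementary.mono {α β : Type*} {k : ℕ} {G : Graph α β} {φ : β → Option (Fin k)}
    {S S' : Set α} (h : IsElementary G φ S) (hS : S' ⊆ S) : IsElementary G φ S' :=
  fun x hx y hy => h x (hS hx) y (hS hy)

/-! ### Leaving the tree and returning -/

section Exit

variable {α β : Type*} {k : ℕ} {G : Graph α β} {φ : β → Option (Fin k)} {e₀ : β}
  {R : (β → Option (Fin k)) → Prop} {S : Set α} {F : Set β} {a b : Fin k} {m : ℕ} {f : ℕ → α}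
  {g : ℕ → β}

/-- All edges of a defective colour leaving a maximal tree belong to the chain from the vertex
missing an unused colour. -/
lemma KempeClass.exists_edge_of_boundary (hR : KempeClass G e₀ R) (hφ : R φ)
    (hT : IsTashkinovTree G φ e₀ S F) (hmax : ∀ ψ, R ψ → (W G ψ e₀).ncard ≤ S.ncard)
    (h : IsChain G φ a b m f g) (hc : IsClosedChain G φ a b m f g) (h0 : f 0 ∈ S)
    (hb : Missing G φ b (f 0)) (hbF : b ∉ usedColours φ F) (ha : a ∉ missingColours G φ S) {e : β}
    (he : e ∈ boundaryEdges G φ S a) : ∃ j < m, e = g j := by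
  obtain ⟨hea, u, hu, v, hv, huv⟩ := he
  have hs := hR.sameComponent_of_boundary hφ hT hmax h0 hb hbF ha huv hu hv hea
  obtain ⟨i, hi, rfl⟩ := hc.exists_of_sameComponent h hs
  exact hc i hi e huv.inc_left (Or.inl hea)

/-- The chain leaves the tree, has at least two vertices outside and returns to the tree. -/
lemma KempeClass.exists_exitChain (hR : KempeClass G e₀ R) (hφ : R φ)
    (hT : IsTashkinovTree G φ e₀ S F) (hmax : ∀ ψ, R ψ → (W G ψ e₀).ncard ≤ S.ncard)
    (h : IsChain G φ a b m f g) (hc : IsClosedChain G φ a b m f g) (h0 : f 0 ∈ S)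
    (hb : Missing G φ b (f 0)) (hbF : b ∉ usedColours φ F) (ha : a ∉ missingColours G φ S)
    (hB : ∃ e₁ ∈ boundaryEdges G φ S a, ∃ e₂ ∈ boundaryEdges G φ S a, e₁ ≠ e₂) :
    ∃ s t, IsExitChain G S F a b m f g s t φ ∧ s + 1 < t ∧ f t ∈ S := by
  classical
  have hedge : ∀ e ∈ boundaryEdges G φ S a, ∃ j < m, e = g j := fun e he =>
    hR.exists_edge_of_boundary hφ hT hmax h hc h0 hb hbF ha he
  have hcross : ∀ j < m, g j ∈ boundaryEdges G φ S a →
      (f j ∈ S ∧ f (j + 1) ∉ S) ∨ (f j ∉ S ∧ f (j + 1) ∈ S) := by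
    rintro j hj ⟨-, u, hu, v, hv, huv⟩
    rcases huv.eq_and_eq_or_eq_and_eq (h.isLink j hj) with ⟨rfl, rfl⟩ | ⟨rfl, rfl⟩
    · exact Or.inl ⟨hu, hv⟩
    · exact Or.inr ⟨hv, hu⟩
  have hbS : b ∈ missingColours G φ S := ⟨f 0, h0, hb⟩
  obtain ⟨e₁, he₁, e₂, he₂, hne⟩ := hB
  have hex : ∃ i, i ≤ m ∧ f i ∉ S := by
    obtain ⟨j, hj, rfl⟩ := hedge e₁ he₁
    rcases hcross j hj he₁ with h1 | h1
    · exact ⟨j + 1, hj, h1.2⟩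
    · exact ⟨j, hj.le, h1.1⟩
  obtain ⟨s, ⟨hsm, hsS⟩, hsmin⟩ : ∃ s, (s ≤ m ∧ f s ∉ S) ∧ ∀ i < s, f i ∈ S :=
    ⟨Nat.find hex, Nat.find_spec hex, fun i hi => by
      by_contra hiS
      exact Nat.find_min hex hi ⟨by have := (Nat.find_spec hex).1; omega, hiS⟩⟩
  have hs0 : 0 < s := by
    rcases Nat.eq_zero_or_pos s with rfl | h1
    · exact (hsS h0).elim
    · exact h1
  -- A boundary edge other than `g (s - 1)` lies beyond `f s` on the chain, and one of its ends is
  -- in `S`.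
  have hex' : ∃ i, s < i ∧ i ≤ m ∧ f i ∈ S := by
    obtain ⟨e, he, hes⟩ : ∃ e ∈ boundaryEdges G φ S a, e ≠ g (s - 1) := by
      by_cases h1 : e₁ = g (s - 1)
      · exact ⟨e₂, he₂, fun h2 => hne (h1.trans h2.symm)⟩
      · exact ⟨e₁, he₁, h1⟩
    obtain ⟨j, hj, rfl⟩ := hedge e he
    have hjs : s ≤ j := by
      by_contra! hjs
      rcases Nat.lt_or_ge (j + 1) s with h1 | h1
      · have := hcross j hj he
        have := hsmin j hjs
        have := hsmin _ h1
        tauto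
      · exact hes (by congr 1; omega)
    rcases hcross j hj he with h1 | h1
    · refine ⟨j, lt_of_le_of_ne hjs ?_, hj.le, h1.1⟩
      rintro rfl
      exact hsS h1.1
    · exact ⟨j + 1, by omega, hj, h1.2⟩
  obtain ⟨t, ⟨hst, htm, htS⟩, htmin⟩ : ∃ t, (s < t ∧ t ≤ m ∧ f t ∈ S) ∧
      ∀ i, s ≤ i → i < t → f i ∉ S :=
    ⟨Nat.find hex', Nat.find_spec hex', fun i hi hit hiS => by
      rcases hi.eq_or_lt with rfl | hi
      · exact hsS hiS
      · exact Nat.find_min hex' hit ⟨hi, by have := (Nat.find_spec hex').2.1; omega, hiS⟩⟩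
  refine ⟨s, t, ⟨h, hs0, hst, htm, hsmin, htmin, hb, ha, hbF, e₁, he₁, e₂, he₂, hne⟩, ?_, htS⟩
  -- With a single outer vertex `f s`, both chain edges at it would cross the boundary. No edge of
  -- the missing colour `b` does so, hence both would have colour `a`, against alternation.
  by_contra hts
  obtain rfl : t = s + 1 := by omega
  obtain ⟨r, rfl⟩ : ∃ r, s = r + 1 := ⟨s - 1, by omega⟩
  have hl1 := h.isLink r (by omega)
  have hl2 := h.isLink (r + 1) (by omega)
  have hc1 : φ (g r) ≠ some b := fun hcb =>
    hsS (hR.mem_of_missing hφ hT hmax (hsmin r (by omega)) hl1 hcb hbS)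
  have hc2 : φ (g (r + 1)) ≠ some b := fun hcb =>
    hsS (hR.mem_of_missing hφ hT hmax htS hl2.symm hcb hbS)
  have hne' := h.colour_ne (hR.colouring φ hφ) (i := r) (by omega)
  rw [(h.colour r (by omega)).resolve_right hc1,
    (h.colour (r + 1) (by omega)).resolve_right hc2] at hne'
  exact hne' rfl

end Exit

end EdgeColouring

/-! ### Assembly -/

theorem theorem2 {α β : Type*} (G : Graph α β) (hV : G.vertexSet.Finite) (hE : G.edgeSet.Finite)
    [G.Loopless] (hχ : EdgeColouring.maxDegree G + 2 ≤ EdgeColouring.chromaticIndex G)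
    (k : ℕ) (hk : EdgeColouring.maxDegree G + 1 ≤ k)
    (φ : β → Option (Fin k)) (hφ : EdgeColouring.IsPartialColouring G φ)
    (e₀ : β) (he₀ : e₀ ∈ G.edgeSet) (hφe₀ : φ e₀ = none)
    (h1 : ¬ ∃ ψ : β → Option (Fin k), EdgeColouring.KempeReachable G φ ψ ∧
      ∃ c, ∀ x, G.Inc e₀ x → EdgeColouring.Missing G ψ c x)
    (h2 : ¬ ∃ ψ : β → Option (Fin k), EdgeColouring.KempeReachable G φ ψ ∧
      (EdgeColouring.W G φ e₀).ncard < (EdgeColouring.W G ψ e₀).ncard)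
    (h3 : ¬ (⌈EdgeColouring.density (G.induce (EdgeColouring.W G φ e₀))⌉₊ ≤
        EdgeColouring.chromaticIndex G ∧
      k < ⌈EdgeColouring.density (G.induce (EdgeColouring.W G φ e₀))⌉₊)) :
    (EdgeColouring.IsElementary G φ (EdgeColouring.W G φ e₀) ∧
      (EdgeColouring.defectiveColours G φ (EdgeColouring.W G φ e₀)).Nonempty ∧
      ∀ a ∈ EdgeColouring.defectiveColours G φ (EdgeColouring.W G φ e₀),
        Odd (EdgeColouring.boundaryEdges G φ (EdgeColouring.W G φ e₀) a).ncard) ∧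
    ∀ T : Set α × Set β, EdgeColouring.IsMaximalTashkinovTree G φ e₀ T →
      ∀ b ∈ EdgeColouring.missingColours G φ (EdgeColouring.W G φ e₀) \
        EdgeColouring.usedColours φ T.2,
      ∀ a ∈ EdgeColouring.defectiveColours G φ (EdgeColouring.W G φ e₀),
        (∃! P : EdgeColouring.PathData α β, EdgeColouring.IsMaximalAlternatingPathFrom G φ
          (EdgeColouring.W G φ e₀) a b P) ∧
        ∀ P : EdgeColouring.PathData α β, EdgeColouring.IsMaximalAlternatingPathFrom G φ
            (EdgeColouring.W G φ e₀) a b P →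
          (∀ e ∈ EdgeColouring.boundaryEdges G φ (EdgeColouring.W G φ e₀) a, e ∈ P.edges) ∧
          (∃ w₁ w₂ l, EdgeColouring.outsideVerts (EdgeColouring.W G φ e₀) P = w₁ :: w₂ :: l ∧
            EdgeColouring.IsElementary G φ (EdgeColouring.W G φ e₀ ∪ {w₁, w₂})) ∧
          EdgeColouring.IsElementary G φ (EdgeColouring.W G φ e₀ ∪
            {x | x ∈ EdgeColouring.outsideSegment (EdgeColouring.W G φ e₀) P}) := by
  open EdgeColouring in
  have hR := kempeClass_kempeReachable hV hE hk hφ hφe₀ h1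
  have hφR : KempeReachable G φ φ := Relation.ReflTransGen.refl
  have hel := hR.isElementary_W hφR he₀
  refine ⟨⟨hel, ?_, fun a ha =>
    hR.odd_ncard_boundary hφR he₀ (not_mem_missingColours_of_defective ha)⟩, ?_⟩
  · rw [Set.nonempty_iff_ne_empty]
    intro hempty
    exact h3 ⟨Nat.ceil_le.2 (density_induce_le_chromaticIndex hE hR.finite_W (by omega)),
      Nat.lt_ceil.2 (hR.lt_density_of_defectiveColours_eq_empty hφR he₀ hempty)⟩
  rintro T hT b ⟨⟨v, hv, hbv⟩, hbF⟩ a ha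
  have hT' : IsTashkinovTree G φ e₀ (W G φ e₀) T.2 := hT.fst_eq_W ▸ hT.prop
  have hmax : ∀ ψ, KempeReachable G φ ψ → (W G ψ e₀).ncard ≤ (W G φ e₀).ncard := fun ψ hψ =>
    not_lt.1 fun hlt => h2 ⟨ψ, hψ, hlt⟩
  have haW := not_mem_missingColours_of_defective ha
  have hab : a ≠ b := by
    rintro rfl
    exact haW ⟨v, hv, hbv⟩
  have : Nonempty β := ⟨e₀⟩
  obtain ⟨m, f, g, rfl, hch, hcl⟩ := exists_isClosedChain hV hφ
    (Or.inr hbv : Missing G φ a v ∨ Missing G φ b v)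
  have hP : IsMaximalAlternatingPathFrom G φ (W G φ e₀) a b (PathData.ofChain m f g) :=
    ⟨hch.isMaximalAlternatingPath hcl hφ (W_subset_vertexSet hv), f 0, hv, by
      simp [PathData.ofChain, List.range_succ_eq_map]⟩
  have huniq : ∀ P, IsMaximalAlternatingPathFrom G φ (W G φ e₀) a b P →
      P = PathData.ofChain m f g := by
    rintro P ⟨hP, x, hx, hxP⟩
    obtain ⟨n, f', g', hch', hcl', rfl⟩ := hP.exists_chain e₀
    obtain rfl : f' 0 = x := by
      simpa [PathData.ofChain, List.range_succ_eq_map] using hxP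
    -- The first vertex of a whole component misses one of its colours, and `a` is not missing in
    -- `W`. Elementarity then leaves only one starting vertex.
    have hmiss : Missing G φ b (f' 0) := (hch'.missing_start hcl' hab).resolve_left fun h =>
      haW ⟨_, hx, h⟩
    have hff : f 0 = f' 0 := by
      by_contra hne
      exact hel _ hv _ hx hne b ⟨hbv, hmiss⟩
    exact hch.ofChain_eq hch' hcl hcl' hφ (Or.inr hbv) hff
  refine ⟨⟨_, hP, huniq⟩, fun P hP' => ?_⟩
  rw [huniq P hP']
  obtain ⟨e₁, he₁, e₂, he₂, hne⟩ := Set.one_lt_ncard_iff_nontrivial_and_finite.1 ha |>.1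
  obtain ⟨s, t, hexit, hst, htW⟩ := hR.exists_exitChain hφR hT' hmax hch hcl hv hbv hbF haW
    ⟨e₁, he₁, e₂, he₂, hne⟩
  have hle := hexit.le
  have helem := IsExitChain.isElementary_exitSet hR hmax (j := t) hexit.lt.le le_rfl φ hφR hT' hexit
  have hs1 := hexit.not_mem s le_rfl (by omega)
  have hs2 := hexit.not_mem (s + 1) (by omega) hst
  refine ⟨fun e he => ?_, ?_, ?_⟩
  · obtain ⟨j, hj, rfl⟩ := hR.exists_edge_of_boundary hφR hT' hmax hch hcl hv hbv hbF haW he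
    exact List.mem_map.2 ⟨j, List.mem_range.2 hj, rfl⟩
  · obtain ⟨l, hl⟩ := outsideVerts_ofChain (g := g) hexit.mem (m := m) (by omega) hs1 hs2
    refine ⟨_, _, l, hl, helem.mono ?_⟩
    rintro x (hx | rfl | rfl)
    · exact Or.inl hx
    · exact IsExitChain.mem_exitSet le_rfl (by omega)
    · exact IsExitChain.mem_exitSet (by omega) hst
  · refine helem.mono ?_
    rintro x (hx | hx)
    · exact Or.inl hx
    · exact Or.inr (exists_of_mem_outsideSegment hexit.mem hs1 hexit.lt hle htW hx)
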